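/- Let $d\ge 1$, let $\Omega\subset\mathbb R^d$ be a bounded convex domain with smooth boundary and $|\Omega|=1$, with unit outgoing normal $n$, and let $\lambda_2$ be the second (first positive) eigenvalue of $-\Delta$ on $\Omega$ with homogeneous Neumann boundary conditions, that is, the infimum of $\int_\Omega|\nabla u|^2\,dx\big/\int_\Omega u^2\,dx$ over all $u\in H^1(\Omega)\setminus\{0\}$ with $\int_\Omega u\,dx=0$. Let $p>0$, $p\ne1$, and $$\theta_\star(p,d)=\frac{(d-1)^2\,p}{d\,(d+2)+p}\,,\qquad \theta\in\big(\theta_\star(p,d),1\big)$$ (for $d\ge3$ the existence of such a $\theta$ means $p<\frac{d+2}{d-2}$). For $\Lambda\in\mathbb R$ put $$\mathcal J_\Lambda[u]=\|\nabla u\|_{L^2(\Omega)}^2-\frac{\Lambda}{p-1}\Big[\|u\|_{L^{p+1}(\Omega)}^2-\|u\|_{L^2(\Omega)}^2\Big].$$ For $\beta\in\mathbb R$ put $\kappa=\beta\,(p-1)+1$ and $$R=R(\beta)=-\frac1\theta\Big(\frac{d-1}{d+2}\Big)^2(\kappa+\beta-1)^2+\kappa\,(\beta-1)+(\kappa+\beta-1)\,\frac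 d{d+2}=-\big(a\,\beta^2-2\,b\,\beta+1\big),$$ $$a=\Big(\frac{d-1}{d+2}\Big)^2\frac{p^2}\theta-p+1\,,\qquad b=1-\frac p{d+2}\,,$$ and, if $a\neq0$, $\beta_\pm=\beta_\pm(\theta,p,d)=\frac{b\pm\sqrt{b^2-a}}a$. 1. If $a\ne0$, then $\beta_-\neq\beta_+$ and these are exactly the roots of $R(\beta)=0$. If $a>0$, then $\beta_-<\beta_+$ and $R(\beta)>0$ if and only if $\beta\in(\beta_-,\beta_+)$. 2. Let $\beta$ be such that $R=R(\beta)>0$ (that is, $\beta\in(\beta_-,\beta_+)$ if $a>0$), let $\Lambda\le(1-\theta)\,\lambda_2$, let $I\subset\mathbb R$ be a nondegenerate interval and let $v$ be a positive classical solution on $I\times\overline\Omega$ of $$\frac{\partial v}{\partial t}=v^{2-2\beta}\Big(\Delta v+\kappa\,\frac{|\nabla v|^2}v\Big)\ \text{in }\Omega\,,\qquad \partial_nv=0\ \text{on }\partial\Omega\,,$$ meaning that $v>0$ on $I\times\overline\Omega$, that $v$ and its spatial derivatives of order at most $2$ are continuous on $I\times\overline\Omega$, and that $v(t,\cdot)\in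 C^3(\overline\Omega)$ for every $t\in I$. Then for every $t\in I$ the function $|\nabla v(t,\cdot)|^4/v(t,\cdot)^2$ is integrable on $\Omega$, the function $t\mapsto\mathcal J_\Lambda[v(t,\cdot)^\beta]$ is differentiable at $t$ (one-sidedly at an end point of $I$), and $$\frac d{dt}\,\mathcal J_\Lambda[v^\beta]\le-\,R\,\beta^2\int_\Omega\frac{|\nabla v|^4}{v^2}\,dx\,.$$ -/

import Mathlib

open Set MeasureTheory
open scoped Gradient Laplacian ContDiff

namespace NeumannFlow

/-- Euclidean space of dimension `d`. -/
abbrev E (d : ℕ) : Type := EuclideanSpace ℝ (Fin d)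

/-! ### Smooth domains and their normals -/

/-- `ρ` is a smooth local defining function of `Ω` near the boundary point `x`:
on the open neighbourhood `U` of `x`, `Ω` is the set `ρ < 0`, and `∇ρ(x) ≠ 0`. -/
structure IsLocalDefiningFunction {d : ℕ} (Ω : Set (E d)) (x : E d) (U : Set (E d))
    (ρ : E d → ℝ) : Prop where
  isOpen : IsOpen U
  mem : x ∈ U
  smooth : ContDiffOn ℝ ∞ ρ U
  gradient_ne_zero : ∇ ρ x ≠ 0
  inter_eq : Ω ∩ U = {y ∈ U | ρ y < 0}

/-- `Ω` has a smooth boundary. -/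
def HasSmoothBoundary {d : ℕ} (Ω : Set (E d)) : Prop :=
  ∀ x ∈ frontier Ω, ∃ U ρ, IsLocalDefiningFunction Ω x U ρ

/-- `n` is the unit outgoing normal vector of `Ω` at `x`: it is the direction of the gradient
of a local defining function. -/
def IsUnitOuterNormal {d : ℕ} (Ω : Set (E d)) (x n : E d) : Prop :=
  ‖n‖ = 1 ∧ ∃ U ρ, IsLocalDefiningFunction Ω x U ρ ∧ ∃ c : ℝ, 0 < c ∧ ∇ ρ x = c • n

/-- The homogeneous Neumann condition `∂ₙ f = 0` on `∂Ω`, for a function `f` that is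
differentiable up to the boundary. -/
def NeumannCondition {d : ℕ} (Ω : Set (E d)) (f : E d → ℝ) : Prop :=
  ∀ x ∈ frontier Ω, ∀ n, IsUnitOuterNormal Ω x n → fderivWithin ℝ f (closure Ω) x n = 0

/-! ### The spectral gap -/

/-- `G` is the weak gradient of `u` in `Ω`. -/
def IsWeakGradient {d : ℕ} (Ω : Set (E d)) (u : E d → ℝ) (G : E d → E d) : Prop :=
  ∀ φ : E d → ℝ, ContDiff ℝ ∞ φ → HasCompactSupport φ → tsupport φ ⊆ Ω →
    ∫ x in Ω, u x • ∇ φ x = - ∫ x in Ω, φ x • G x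

/-- `u` belongs to the Sobolev space `H¹(Ω)`, with weak gradient `G`. -/
structure MemH1 {d : ℕ} (Ω : Set (E d)) (u : E d → ℝ) (G : E d → E d) : Prop where
  memLp : MemLp u 2 (volume.restrict Ω)
  memLp_grad : MemLp G 2 (volume.restrict Ω)
  weakGradient : IsWeakGradient Ω u G

/-- The second eigenvalue of `-Δ` on `Ω` with homogeneous Neumann boundary conditions: the
infimum of the Rayleigh quotient over the nonzero functions of `H¹(Ω)` that are orthogonal to
the constants. -/
noncomputable def lambda2 {d : ℕ} (Ω : Set (E d)) : ℝ :=
  sInf {r : ℝ | ∃ u G, MemH1 Ω u G ∧ ∫ x in Ω, u x = 0 ∧ 0 < ∫ x in Ω, u x ^ 2 ∧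
    r = (∫ x in Ω, ‖G x‖ ^ 2) / ∫ x in Ω, u x ^ 2}

/-! ### The functional -/

/-- The norm of `u` in `L^q(Ω)`, for `0 < q < ∞`. -/
noncomputable def normL {d : ℕ} (Ω : Set (E d)) (q : ℝ) (u : E d → ℝ) : ℝ :=
  (∫ x in Ω, |u x| ^ q) ^ (1 / q)

/-- `J_Λ[u] = ‖∇u‖₂² - Λ/(p-1) (‖u‖_{p+1}² - ‖u‖₂²)`. -/
noncomputable def functionalJ {d : ℕ} (Ω : Set (E d)) (p Λ : ℝ) (u : E d → ℝ) : ℝ :=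
  (∫ x in Ω, ‖∇ u x‖ ^ 2) - Λ / (p - 1) * (normL Ω (p + 1) u ^ 2 - normL Ω 2 u ^ 2)

/-! ### The parameters -/

/-- `θ⋆(p,d)`. -/
noncomputable def thetaStar (p : ℝ) (d : ℕ) : ℝ :=
  ((d : ℝ) - 1) ^ 2 * p / ((d : ℝ) * (d + 2) + p)

/-- `κ = β (p - 1) + 1`. -/
def kappa (p β : ℝ) : ℝ := β * (p - 1) + 1

/-- The constant `R`. -/
noncomputable def constR (θ p : ℝ) (d : ℕ) (β : ℝ) : ℝ :=
  -(1 / θ) * (((d : ℝ) - 1) / (d + 2)) ^ 2 * (kappa p β + β - 1) ^ 2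
    + kappa p β * (β - 1) + (kappa p β + β - 1) * ((d : ℝ) / (d + 2))

/-- The coefficient `a` in `R = -(a β² - 2 b β + 1)`. -/
noncomputable def coefA (θ p : ℝ) (d : ℕ) : ℝ :=
  (((d : ℝ) - 1) / (d + 2)) ^ 2 * (p ^ 2 / θ) - p + 1

/-- The coefficient `b` in `R = -(a β² - 2 b β + 1)`. -/
noncomputable def coefB (p : ℝ) (d : ℕ) : ℝ := 1 - p / (d + 2)

/-- The root `β₋(θ,p,d) = (b - √(b² - a)) / a` of `R = 0`, where `a ≠ 0`. -/
noncomputable def betaMinus (θ p : ℝ) (d : ℕ) : ℝ :=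
  (coefB p d - √(coefB p d ^ 2 - coefA θ p d)) / coefA θ p d

/-- The root `β₊(θ,p,d) = (b + √(b² - a)) / a` of `R = 0`, where `a ≠ 0`. -/
noncomputable def betaPlus (θ p : ℝ) (d : ℕ) : ℝ :=
  (coefB p d + √(coefB p d ^ 2 - coefA θ p d)) / coefA θ p d

/-! ### The flow -/

/-- `v` is a positive classical solution, on the time interval `I`, of
`∂v/∂t = v^(2-2β) (Δv + κ |∇v|²/v)` in `Ω` with `∂ₙ v = 0` on `∂Ω`.
The spatial derivatives of order at most two are continuous on `I × closure Ω`, and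
`v(t,·)` is of class `C³` up to the boundary for each `t`. At an end point of `I` which belongs
to `I`, the time derivative is one-sided. -/
structure IsFlowSolution {d : ℕ} (Ω : Set (E d)) (p β : ℝ) (I : Set ℝ) (v : ℝ → E d → ℝ) :
    Prop where
  pos : ∀ t ∈ I, ∀ x ∈ closure Ω, 0 < v t x
  contDiffOn : ∀ t ∈ I, ContDiffOn ℝ 3 (v t) (closure Ω)
  continuousOn : ∀ k : ℕ, k ≤ 2 → ContinuousOn
    (fun z : ℝ × E d => iteratedFDerivWithin ℝ k (v z.1) (closure Ω) z.2) (I ×ˢ closure Ω)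
  equation : ∀ t ∈ I, ∀ x ∈ Ω, HasDerivWithinAt (fun s => v s x)
    (v t x ^ (2 - 2 * β) * (Δ (v t) x + kappa p β * (‖∇ (v t) x‖ ^ 2 / v t x))) I t
  neumann : ∀ t ∈ I, NeumannCondition Ω (v t)

end NeumannFlow

/-!
A convex domain is approximated from inside by cutoffs that are functions of its gauge. Their
gradients point inwards, so that the divergence formula, and its inequality version for fields
that point outwards at the boundary, follow without a surface measure. Under the Neumann
condition convexity gives `∂ₙ|∇v|² ≤ 0` on the boundary, and integrating Bochner's formula yields
`∫ |D²v|² ≤ ∫ (Δv)²`; the Poincaré inequality for `v - ⨍ v` gives `λ₂ ∫ |∇v|² ≤ ∫ (Δv)²`.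
Applying `|tr A|² ≤ d |A|²` to `A = D²v - γ ∇v ⊗ ∇v / v` and optimising in `γ` turns a fraction `θ`
of `∫ (Δv)²` into a multiple of `∫ |∇v|⁴ / v²`, which makes the constant `R` appear.
Along the flow `‖v^β‖_{p+1}` is constant, and the derivative of `J_Λ[v^β]` is
`-2 β² (∫ (Δv + (β-1) |∇v|²/v) (Δv + κ |∇v|²/v) - Λ ∫ |∇v|²)`, to which these inequalities apply.
-/

namespace NeumannFlow

open Filter Topology
open scoped NNReal InnerProductSpace

/-! ### The gauge of a convex set and its cutoffs -/

section Gauge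

variable {V : Type*} [NormedAddCommGroup V] {Ω : Set V} {x₀ x : V} {ε : ℝ}

theorem preimage_add_mem_nhds_zero (ho : IsOpen Ω) (hx₀ : x₀ ∈ Ω) :
    (x₀ + ·) ⁻¹' Ω ∈ 𝓝 (0 : V) :=
  (ho.preimage (by fun_prop)).mem_nhds (by simpa using hx₀)

variable [NormedSpace ℝ V]

/-- The Minkowski gauge of `Ω` with respect to the centre `x₀`. For a convex open `Ω ∋ x₀` it is a
Lipschitz function that is `< 1` exactly on `Ω` and `= 1` exactly on the boundary. -/
noncomputable def centeredGauge (Ω : Set V) (x₀ x : V) : ℝ :=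
  gauge ((x₀ + ·) ⁻¹' Ω) (x - x₀)

theorem centeredGauge_lt_one_iff (ho : IsOpen Ω) (hc : Convex ℝ Ω) (hx₀ : x₀ ∈ Ω) :
    centeredGauge Ω x₀ x < 1 ↔ x ∈ Ω := by
  rw [centeredGauge, gauge_lt_one_iff_mem_interior (hc.translate_preimage_right x₀)
    (preimage_add_mem_nhds_zero ho hx₀), (ho.preimage (by fun_prop)).interior_eq]
  simp

theorem centeredGauge_eq_one_iff (ho : IsOpen Ω) (hc : Convex ℝ Ω) (hx₀ : x₀ ∈ Ω) :
    centeredGauge Ω x₀ x = 1 ↔ x ∈ frontier Ω := by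
  have hfrontier : frontier ((x₀ + ·) ⁻¹' Ω) = (x₀ + ·) ⁻¹' frontier Ω :=
    ((Homeomorph.addLeft x₀).preimage_frontier Ω).symm
  rw [centeredGauge, gauge_eq_one_iff_mem_frontier (hc.translate_preimage_right x₀)
    (preimage_add_mem_nhds_zero ho hx₀), hfrontier]
  simp

theorem exists_lipschitzWith_centeredGauge (ho : IsOpen Ω) (hc : Convex ℝ Ω) (hx₀ : x₀ ∈ Ω) :
    ∃ K : ℝ≥0, LipschitzWith K (centeredGauge Ω x₀) := by
  obtain ⟨K, hK⟩ := (hc.translate_preimage_right x₀).lipschitz_gauge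
    (preimage_add_mem_nhds_zero ho hx₀)
  refine ⟨K, LipschitzWith.of_dist_le_mul fun x y => ?_⟩
  simpa [centeredGauge] using hK.dist_le_mul (x - x₀) (y - x₀)

theorem centeredGauge_dilation {r : ℝ} (hr : 0 ≤ r) (x : V) :
    centeredGauge Ω x₀ (x₀ + r • (x - x₀)) = r * centeredGauge Ω x₀ x := by
  simp [centeredGauge, gauge_smul_of_nonneg hr]

theorem add_inv_centeredGauge_smul_mem_frontier (ho : IsOpen Ω) (hc : Convex ℝ Ω) (hx₀ : x₀ ∈ Ω)
    (hx : 0 < centeredGauge Ω x₀ x) :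
    x₀ + (centeredGauge Ω x₀ x)⁻¹ • (x - x₀) ∈ frontier Ω := by
  rw [← centeredGauge_eq_one_iff ho hc hx₀, centeredGauge_dilation (inv_nonneg.2 hx.le),
    inv_mul_cancel₀ hx.ne']

theorem hasFDerivAt_centeredGauge_dilation {r : ℝ} (hr : 0 < r) {A : V →L[ℝ] ℝ}
    (hA : HasFDerivAt (centeredGauge Ω x₀) A x) :
    HasFDerivAt (centeredGauge Ω x₀) A (x₀ + r⁻¹ • (x - x₀)) := by
  have hx : x₀ + r • (x₀ + r⁻¹ • (x - x₀) - x₀) = x := by simp [smul_smul, hr.ne']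
  have hdil : HasFDerivAt (fun z : V => x₀ + r • (z - x₀)) (r • ContinuousLinearMap.id ℝ V)
      (x₀ + r⁻¹ • (x - x₀)) :=
    (((hasFDerivAt_id _).sub_const x₀).const_smul r).const_add x₀
  have hcomp := (HasFDerivAt.comp (f := fun z : V => x₀ + r • (z - x₀)) _
    (hx.symm ▸ hA) hdil).const_smul r⁻¹
  refine (hcomp.congr_fderiv ?_).congr_of_eventuallyEq (.of_forall fun z => ?_)
  · ext z
    simp [hr.ne']
  · simp [centeredGauge_dilation hr.le, hr.ne']

/-- The Lipschitz cutoff that vanishes outside `Ω`, equals `1` where the gauge is at most `1 - ε`,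
and is affine in the gauge in between. -/
noncomputable def gaugeCutoff (Ω : Set V) (x₀ : V) (ε : ℝ) (x : V) : ℝ :=
  max 0 (min 1 (ε⁻¹ * (1 - centeredGauge Ω x₀ x)))

theorem gaugeCutoff_nonneg : 0 ≤ gaugeCutoff Ω x₀ ε x := le_max_left _ _

theorem gaugeCutoff_le_one : gaugeCutoff Ω x₀ ε x ≤ 1 := max_le zero_le_one (min_le_left _ _)

theorem gaugeCutoff_eq_zero (hε : 0 < ε) (hx : 1 ≤ centeredGauge Ω x₀ x) :
    gaugeCutoff Ω x₀ ε x = 0 :=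
  max_eq_left ((min_le_right _ _).trans
    (mul_nonpos_of_nonneg_of_nonpos (inv_nonneg.2 hε.le) (sub_nonpos.2 hx)))

theorem gaugeCutoff_eq_one (hε : 0 < ε) (hx : centeredGauge Ω x₀ x ≤ 1 - ε) :
    gaugeCutoff Ω x₀ ε x = 1 := by
  have h : 1 ≤ ε⁻¹ * (1 - centeredGauge Ω x₀ x) := by
    rw [le_inv_mul_iff₀ hε]
    linarith
  rw [gaugeCutoff, min_eq_left h, max_eq_right zero_le_one]

theorem gaugeCutoff_eq_inv_mul (hε : 0 < ε)
    (hx : centeredGauge Ω x₀ x ∈ Ioo (1 - ε) 1) :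
    gaugeCutoff Ω x₀ ε x = ε⁻¹ * (1 - centeredGauge Ω x₀ x) := by
  have h₁ : ε⁻¹ * (1 - centeredGauge Ω x₀ x) ≤ 1 := by
    rw [inv_mul_le_iff₀ hε]
    linarith [hx.1]
  rw [gaugeCutoff, min_eq_right h₁,
    max_eq_right (mul_nonneg (inv_nonneg.2 hε.le) (sub_nonneg.2 hx.2.le))]

theorem exists_lipschitzWith_gaugeCutoff (ho : IsOpen Ω) (hc : Convex ℝ Ω) (hx₀ : x₀ ∈ Ω)
    (ε : ℝ) : ∃ K : ℝ≥0, LipschitzWith K (gaugeCutoff Ω x₀ ε) := by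
  obtain ⟨K, hK⟩ := exists_lipschitzWith_centeredGauge ho hc hx₀
  exact ⟨_, (((lipschitzWith_smul ε⁻¹).comp ((LipschitzWith.const 1).sub hK)).const_min
    1).const_max 0⟩

theorem hasCompactSupport_gaugeCutoff [ProperSpace V] (ho : IsOpen Ω)
    (hb : Bornology.IsBounded Ω) (hc : Convex ℝ Ω) (hx₀ : x₀ ∈ Ω) (hε : 0 < ε) :
    HasCompactSupport (gaugeCutoff Ω x₀ ε) :=
  HasCompactSupport.intro hb.isCompact_closure fun _ hx => gaugeCutoff_eq_zero hε <|
    not_lt.1 fun h => hx (subset_closure ((centeredGauge_lt_one_iff ho hc hx₀).1 h))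

theorem fderiv_gaugeCutoff_eq_zero (hε : 0 < ε) (hx : centeredGauge Ω x₀ x ∉ Ioo (1 - ε) 1) :
    fderiv ℝ (gaugeCutoff Ω x₀ ε) x = 0 := by
  rcases le_or_gt (centeredGauge Ω x₀ x) (1 - ε) with hin | hin
  · refine IsLocalMax.fderiv_eq_zero (Eventually.of_forall fun z => ?_)
    rw [gaugeCutoff_eq_one hε hin]
    exact gaugeCutoff_le_one
  · refine IsLocalMin.fderiv_eq_zero (Eventually.of_forall fun z => ?_)
    rw [gaugeCutoff_eq_zero hε (not_lt.1 fun h => hx ⟨hin, h⟩)]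
    exact gaugeCutoff_nonneg

theorem fderiv_gaugeCutoff (ho : IsOpen Ω) (hc : Convex ℝ Ω) (hx₀ : x₀ ∈ Ω) (hε : 0 < ε)
    (hx : centeredGauge Ω x₀ x ∈ Ioo (1 - ε) 1) :
    fderiv ℝ (gaugeCutoff Ω x₀ ε) x = -(ε⁻¹ • fderiv ℝ (centeredGauge Ω x₀) x) := by
  obtain ⟨K, hK⟩ := exists_lipschitzWith_centeredGauge ho hc hx₀
  have heq : gaugeCutoff Ω x₀ ε =ᶠ[𝓝 x] ε⁻¹ • fun z => 1 - centeredGauge Ω x₀ z :=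
    (hK.continuous.continuousAt.eventually (Ioo_mem_nhds hx.1 hx.2)).mono
      fun z hz => gaugeCutoff_eq_inv_mul hε hz
  rw [heq.fderiv_eq, fderiv_const_smul_field, Pi.smul_apply, fderiv_const_sub, smul_neg]

/-- `F` points outwards on `∂Ω`, as measured by the derivative of the gauge wherever it exists. -/
def IsOutwardForGauge (Ω : Set V) (x₀ : V) (F : V → V) : Prop :=
  ∀ y ∈ frontier Ω, ∀ A : V →L[ℝ] ℝ, HasFDerivAt (centeredGauge Ω x₀) A y → 0 ≤ A (F y)

-- The gauge has the same derivative at `x` and at the boundary point `y` on the ray from `x₀`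
-- through `x`, and `‖x - y‖ = O(ε)`.
theorem IsOutwardForGauge.neg_le_fderiv (ho : IsOpen Ω) (hc : Convex ℝ Ω) (hx₀ : x₀ ∈ Ω)
    {F : V → V} (hF : IsOutwardForGauge Ω x₀ F) {K L : ℝ≥0}
    (hK : LipschitzWith K (centeredGauge Ω x₀)) (hL : LipschitzWith L F) {M : ℝ}
    (hM : ‖x - x₀‖ ≤ M) (hε : ε ≤ 1 / 2) (hx : centeredGauge Ω x₀ x ∈ Ioo (1 - ε) 1)
    (hdiff : DifferentiableAt ℝ (centeredGauge Ω x₀) x) :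
    -(ε * (2 * (K * L * M))) ≤ fderiv ℝ (centeredGauge Ω x₀) x (F x) := by
  set g := centeredGauge Ω x₀ x
  set A := fderiv ℝ (centeredGauge Ω x₀) x
  set y := x₀ + g⁻¹ • (x - x₀)
  have hg : 0 < g := by linarith [hx.1]
  have hout : 0 ≤ A (F y) := hF y (add_inv_centeredGauge_smul_mem_frontier ho hc hx₀ hg) A
    (hasFDerivAt_centeredGauge_dilation hg hdiff.hasFDerivAt)
  have hxy : ‖x - y‖ ≤ 2 * ε * M := by
    have hsub : x - y = -((1 - g) / g) • (x - x₀) := by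
      rw [sub_div, div_self hg.ne', one_div, neg_sub, sub_smul, one_smul]
      simp only [y]
      abel
    have hfactor : |-((1 - g) / g)| ≤ 2 * ε := by
      rw [abs_neg, abs_of_nonneg (div_nonneg (sub_nonneg.2 hx.2.le) hg.le), div_le_iff₀ hg]
      nlinarith [hx.1, hx.2]
    rw [hsub, norm_smul, Real.norm_eq_abs]
    gcongr
    exact (abs_nonneg _).trans hfactor
  have hdist : |A (F x - F y)| ≤ K * (L * (2 * ε * M)) :=
    calc |A (F x - F y)| ≤ ‖A‖ * ‖F x - F y‖ := A.le_opNorm _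
      _ ≤ K * (L * ‖x - y‖) := by
        gcongr
        · exact norm_fderiv_le_of_lipschitz ℝ hK
        · exact hL.norm_sub_le x y
      _ ≤ K * (L * (2 * ε * M)) := by gcongr
  have hsplit : A (F x) = A (F x - F y) + A (F y) := by rw [map_sub, sub_add_cancel]
  linarith [neg_le_of_abs_le hdist]

end Gauge

theorem integrable_lineDeriv_mul {V : Type*} [NormedAddCommGroup V] [NormedSpace ℝ V]
    [MeasurableSpace V] [BorelSpace V] {μ : Measure V} [IsFiniteMeasureOnCompacts μ]
    {χ f : V → ℝ} {L : ℝ≥0} (hχ : LipschitzWith L χ) (hsupp : HasCompactSupport χ)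
    (hf : Continuous f) (w : V) :
    Integrable (fun x => lineDeriv ℝ χ x w * f x) μ := by
  rw [← integrableOn_iff_integrable_of_support_subset (s := tsupport χ)]
  · exact (hf.continuousOn.integrableOn_compact hsupp).bdd_mul
      (measurable_lineDeriv hχ.continuous).aestronglyMeasurable
      (ae_of_all _ fun x => norm_lineDeriv_le_of_lipschitz ℝ hχ)
  · refine fun x hx => by_contra fun hxs => hx ?_
    have hzero : lineDeriv ℝ χ x w = 0 := by
      rw [(notMem_tsupport_iff_eventuallyEq.1 hxs).lineDeriv_eq]
      simp [lineDeriv]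
    simp [hzero]

section Divergence

variable {V : Type*} [NormedAddCommGroup V] [InnerProductSpace ℝ V] [FiniteDimensional ℝ V]

/-- The trace, as a continuous linear functional on the endomorphisms of a finite-dimensional
space. -/
noncomputable def traceCLM (V : Type*) [NormedAddCommGroup V] [InnerProductSpace ℝ V]
    [FiniteDimensional ℝ V] : (V →L[ℝ] V) →L[ℝ] ℝ :=
  LinearMap.toContinuousLinearMap (LinearMap.trace ℝ V ∘ₗ ContinuousLinearMap.coeLM ℝ)

theorem traceCLM_eq_sum_inner {ι : Type*} [Fintype ι] (b : OrthonormalBasis ι ℝ V)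
    (T : V →L[ℝ] V) : traceCLM V T = ∑ i, ⟪b i, T (b i)⟫_ℝ :=
  LinearMap.trace_eq_sum_inner (T : V →ₗ[ℝ] V) b

variable [MeasurableSpace V] [BorelSpace V]

theorem integral_traceCLM_fderiv_mul (μ : Measure V) [μ.IsAddHaarMeasure] {F : V → V} {K L : ℝ≥0}
    (hF : LipschitzWith K F) {χ : V → ℝ} (hχ : LipschitzWith L χ) (hsupp : HasCompactSupport χ) :
    ∫ x, traceCLM V (fderiv ℝ F x) * χ x ∂μ = -∫ x, fderiv ℝ χ x (F x) ∂μ := by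
  set b := stdOrthonormalBasis ℝ V
  have hFi : ∀ i, LipschitzWith (‖innerSL ℝ (b i)‖₊ * K) fun z => ⟪b i, F z⟫_ℝ := fun i =>
    (innerSL ℝ (b i)).lipschitz.comp hF
  have hdiv : ∀ᵐ x ∂μ, traceCLM V (fderiv ℝ F x) * χ x =
      ∑ i, lineDeriv ℝ (fun z => ⟪b i, F z⟫_ℝ) x (b i) * χ x := by
    filter_upwards [hF.ae_differentiableAt (μ := μ)] with x hx
    rw [traceCLM_eq_sum_inner b, Finset.sum_mul]
    refine Finset.sum_congr rfl fun i _ => ?_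
    have hi : HasFDerivAt (fun z => ⟪b i, F z⟫_ℝ) (innerSL ℝ (b i) ∘L fderiv ℝ F x) x :=
      (innerSL ℝ (b i)).hasFDerivAt.comp x hx.hasFDerivAt
    rw [(hi.hasLineDerivAt (b i)).lineDeriv]
    rfl
  have hgrad : ∀ᵐ x ∂μ, ∑ i, lineDeriv ℝ χ x (-b i) * ⟪b i, F x⟫_ℝ = -fderiv ℝ χ x (F x) := by
    filter_upwards [hχ.ae_differentiableAt (μ := μ)] with x hx
    conv_rhs => rw [← b.sum_repr' (F x), map_sum, ← Finset.sum_neg_distrib]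
    exact Finset.sum_congr rfl fun i _ => by
      rw [hx.lineDeriv_eq_fderiv, map_neg, map_smul, smul_eq_mul]
      ring
  rw [integral_congr_ae hdiv, ← integral_neg, ← integral_congr_ae hgrad,
    integral_finsetSum _ fun i _ => ?_,
    integral_finsetSum _ fun i _ => integrable_lineDeriv_mul hχ hsupp (hFi i).continuous _]
  · exact Finset.sum_congr rfl fun i _ => (hFi i).integral_lineDeriv_mul_eq hχ hsupp (b i)
  · exact (hχ.continuous.integrable_of_hasCompactSupport hsupp).bdd_mul
      (measurable_lineDeriv (hFi i).continuous).aestronglyMeasurable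
      (ae_of_all _ fun x => norm_lineDeriv_le_of_lipschitz ℝ (hFi i))

theorem integrable_traceCLM_fderiv_mul {μ : Measure V} [IsFiniteMeasureOnCompacts μ] {F : V → V}
    {L : ℝ≥0} (hF : LipschitzWith L F) {χ : V → ℝ} (hχ : Continuous χ)
    (hsupp : HasCompactSupport χ) :
    Integrable (fun x => traceCLM V (fderiv ℝ F x) * χ x) μ :=
  (hχ.integrable_of_hasCompactSupport hsupp).bdd_mul (c := ‖traceCLM V‖ * L)
    ((traceCLM V).continuous.comp_aestronglyMeasurable
      (measurable_fderiv ℝ F).stronglyMeasurable.aestronglyMeasurable)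
    (ae_of_all _ fun _ => (traceCLM V).le_opNorm_of_le (norm_fderiv_le_of_lipschitz ℝ hF))

theorem integrable_fderiv_apply {μ : Measure V} [IsFiniteMeasureOnCompacts μ] {χ : V → ℝ}
    {L : ℝ≥0} (hχ : LipschitzWith L χ) (hsupp : HasCompactSupport χ) {F : V → V}
    (hF : Continuous F) : Integrable (fun x => fderiv ℝ χ x (F x)) μ := by
  rw [← integrableOn_iff_integrable_of_support_subset (s := tsupport χ)]
  · refine ((hF.norm.const_mul L).continuousOn.integrableOn_compact hsupp).mono'
      ?_ (ae_of_all _ fun x => ?_)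
    · have hmeas := (measurable_fderiv ℝ χ).stronglyMeasurable.prodMk hF.stronglyMeasurable
      exact isBoundedBilinearMap_apply.continuous.comp_aestronglyMeasurable
        hmeas.aestronglyMeasurable
    · exact (fderiv ℝ χ x).le_of_opNorm_le (norm_fderiv_le_of_lipschitz ℝ hχ) _
  · refine fun x hx => by_contra fun hxs => hx ?_
    have hzero : fderiv ℝ χ x = 0 := image_eq_zero_of_notMem_tsupport
      (notMem_subset (tsupport_fderiv_subset ℝ) hxs)
    simp [hzero]

variable {μ : Measure V} [μ.IsAddHaarMeasure] {Ω : Set V} {x₀ : V}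

theorem setIntegral_traceCLM_fderiv_mul_gaugeCutoff (ho : IsOpen Ω) (hb : Bornology.IsBounded Ω)
    (hc : Convex ℝ Ω) (hx₀ : x₀ ∈ Ω) {F : V → V} {L : ℝ≥0} (hL : LipschitzWith L F) {ε : ℝ}
    (hε : 0 < ε) :
    ∫ x in Ω, traceCLM V (fderiv ℝ F x) * gaugeCutoff Ω x₀ ε x ∂μ =
      -∫ x in Ω, fderiv ℝ (gaugeCutoff Ω x₀ ε) x (F x) ∂μ := by
  obtain ⟨C, hC⟩ := exists_lipschitzWith_gaugeCutoff ho hc hx₀ ε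
  have hout : ∀ x ∉ Ω, 1 ≤ centeredGauge Ω x₀ x := fun x hx =>
    not_lt.1 fun h => hx ((centeredGauge_lt_one_iff ho hc hx₀).1 h)
  rw [setIntegral_eq_integral_of_forall_compl_eq_zero fun x hx => ?_,
    setIntegral_eq_integral_of_forall_compl_eq_zero fun x hx => ?_]
  · exact integral_traceCLM_fderiv_mul μ hL hC (hasCompactSupport_gaugeCutoff ho hb hc hx₀ hε)
  · simp [fderiv_gaugeCutoff_eq_zero hε fun h => (hout x hx).not_gt h.2]
  · simp [gaugeCutoff_eq_zero hε (hout x hx)]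

theorem exists_forall_setIntegral_mul_gaugeCutoff_add_nonneg (ho : IsOpen Ω)
    (hb : Bornology.IsBounded Ω) (hc : Convex ℝ Ω) (hx₀ : x₀ ∈ Ω) {F : V → V} {L : ℝ≥0}
    (hL : LipschitzWith L F) (hF : IsOutwardForGauge Ω x₀ F) :
    ∃ B : ℝ, ∀ ε ∈ Ioc (0 : ℝ) (1 / 2),
      0 ≤ ∫ x in Ω, (traceCLM V (fderiv ℝ F x) * gaugeCutoff Ω x₀ ε x +
        (centeredGauge Ω x₀ ⁻¹' Ioo (1 - ε) 1).indicator (fun _ => B) x) ∂μ := by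
  obtain ⟨K, hK⟩ := exists_lipschitzWith_centeredGauge ho hc hx₀
  obtain ⟨M, hM⟩ := hb.subset_closedBall x₀
  refine ⟨2 * (K * L * M), fun ε hε => ?_⟩
  obtain ⟨C, hC⟩ := exists_lipschitzWith_gaugeCutoff ho hc hx₀ ε
  have hsupp := hasCompactSupport_gaugeCutoff ho hb hc hx₀ hε.1
  have hindicator : IntegrableOn ((centeredGauge Ω x₀ ⁻¹' Ioo (1 - ε) 1).indicator
      fun _ => 2 * (K * L * M)) Ω μ :=
    (integrableOn_const hb.measure_lt_top.ne).indicator (hK.continuous.measurable measurableSet_Ioo)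
  rw [integral_add (integrable_traceCLM_fderiv_mul hL hC.continuous hsupp).integrableOn hindicator,
    setIntegral_traceCLM_fderiv_mul_gaugeCutoff ho hb hc hx₀ hL hε.1, ← integral_neg,
    ← integral_add (integrable_fderiv_apply hC hsupp hL.continuous).integrableOn.fun_neg hindicator]
  refine setIntegral_nonneg_of_ae_restrict ?_
  filter_upwards [ae_restrict_of_ae hK.ae_differentiableAt, ae_restrict_mem ho.measurableSet]
    with x hdiff hxΩ
  by_cases hx : x ∈ centeredGauge Ω x₀ ⁻¹' Ioo (1 - ε) 1
  · have hbound := hF.neg_le_fderiv ho hc hx₀ hK hL (mem_closedBall_iff_norm.1 (hM hxΩ))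
      hε.2 hx hdiff
    rw [← neg_mul, ← neg_mul_eq_neg_mul, ← mul_neg, ← le_inv_mul_iff₀ hε.1] at hbound
    simp only [Pi.zero_apply, indicator_of_mem hx, fderiv_gaugeCutoff ho hc hx₀ hε.1 hx,
      neg_apply, smul_apply, smul_eq_mul]
    linarith
  · simp [indicator_of_notMem hx, fderiv_gaugeCutoff_eq_zero hε.1 hx]

theorem setIntegral_traceCLM_fderiv_nonneg (ho : IsOpen Ω) (hb : Bornology.IsBounded Ω)
    (hc : Convex ℝ Ω) (hx₀ : x₀ ∈ Ω) {F : V → V} {L : ℝ≥0} (hL : LipschitzWith L F)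
    (hF : IsOutwardForGauge Ω x₀ F) :
    0 ≤ ∫ x in Ω, traceCLM V (fderiv ℝ F x) ∂μ := by
  obtain ⟨B, hB⟩ := exists_forall_setIntegral_mul_gaugeCutoff_add_nonneg (μ := μ) ho hb hc hx₀ hL hF
  obtain ⟨K, hK⟩ := exists_lipschitzWith_centeredGauge ho hc hx₀
  have htendsto := tendsto_integral_filter_of_dominated_convergence (μ := μ.restrict Ω)
    (l := 𝓝[>] (0 : ℝ)) (f := fun x => traceCLM V (fderiv ℝ F x))
    (F := fun ε x => traceCLM V (fderiv ℝ F x) * gaugeCutoff Ω x₀ ε x +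
      (centeredGauge Ω x₀ ⁻¹' Ioo (1 - ε) 1).indicator (fun _ => B) x)
    (fun _ => ‖traceCLM V‖ * L + |B|) (.of_forall fun ε => ?_) (.of_forall fun ε => ?_)
    (integrableOn_const hb.measure_lt_top.ne) ?_
  · refine ge_of_tendsto htendsto ?_
    filter_upwards [Ioc_mem_nhdsGT (show (0 : ℝ) < 1 / 2 by norm_num)] with ε hε using hB ε hε
  · obtain ⟨C, hC⟩ := exists_lipschitzWith_gaugeCutoff ho hc hx₀ ε
    have hdiv := (traceCLM V).continuous.comp_stronglyMeasurable
      (measurable_fderiv ℝ F).stronglyMeasurable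
    exact ((hdiv.mul hC.continuous.stronglyMeasurable).add (stronglyMeasurable_const.indicator
      (hK.continuous.measurable measurableSet_Ioo))).aestronglyMeasurable
  · refine ae_of_all _ fun x => norm_add_le_of_le ?_ (norm_indicator_le_norm_self _ _)
    rw [norm_mul, Real.norm_of_nonneg gaugeCutoff_nonneg]
    exact (mul_le_of_le_one_right (norm_nonneg _) gaugeCutoff_le_one).trans
      ((traceCLM V).le_opNorm_of_le (norm_fderiv_le_of_lipschitz ℝ hL))
  · filter_upwards [ae_restrict_mem ho.measurableSet] with x hx
    have hlt := (centeredGauge_lt_one_iff ho hc hx₀).2 hx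
    refine tendsto_const_nhds.congr' ?_
    filter_upwards [Ioc_mem_nhdsGT (sub_pos.2 hlt)] with ε hε
    have hle : centeredGauge Ω x₀ x ≤ 1 - ε := by linarith [hε.2]
    rw [gaugeCutoff_eq_one hε.1 hle, indicator_of_notMem fun h => hle.not_gt h.1]
    simp

end Divergence

/-! ### Smooth boundaries of convex sets -/

theorem exists_hasDerivAt_levelSet {V : Type*} [NormedAddCommGroup V] [NormedSpace ℝ V]
    [CompleteSpace V] {f : V → ℝ} {A : V →L[ℝ] ℝ} {a w : V} (hf : HasStrictFDerivAt f A a)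
    (hA : A ≠ 0) (hw : A w = 0) :
    ∃ z : ℝ → V, z 0 = a ∧ HasDerivAt z w 0 ∧ ∀ᶠ s in 𝓝 0, f (z s) = f a := by
  have hrange : A.range = ⊤ := Module.Dual.range_eq_top_of_ne_zero (by exact_mod_cast hA)
  let k : A.ker := ⟨w, hw⟩
  have hk : HasDerivAt (fun s : ℝ => s • k) k 0 := by
    simpa using (hasDerivAt_id (0 : ℝ)).smul_const k
  refine ⟨fun s => hf.implicitFunction f A hrange (f a) (s • k), by simp,
    (hf.to_implicitFunction hrange).hasFDerivAt.comp_hasDerivAt_of_eq 0 hk (by simp), ?_⟩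
  have htendsto : Tendsto (fun s : ℝ => (f a, s • k)) (𝓝 0) (𝓝 (f a, 0)) :=
    tendsto_const_nhds.prodMk_nhds (by simpa using hk.continuousAt.tendsto)
  exact htendsto.eventually (hf.map_implicitFunction_eq hrange)

theorem hasDerivAt_comp_add_smul {V : Type*} [NormedAddCommGroup V] [NormedSpace ℝ V] {f : V → ℝ}
    {A : V →L[ℝ] ℝ} {x : V} (hf : HasFDerivAt f A x) (u : V) :
    HasDerivAt (fun s : ℝ => f (x + s • u)) (A u) 0 :=
  hf.comp_hasDerivAt_of_eq 0 (by simpa using ((hasDerivAt_id (0 : ℝ)).smul_const u).const_add x)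
    (by simp)

section Boundary

variable {d : ℕ} {Ω U : Set (E d)} {ρ : E d → ℝ} {x₀ x y n u w : E d}

namespace IsLocalDefiningFunction

theorem mem_nhds (hρ : IsLocalDefiningFunction Ω x U ρ) : U ∈ 𝓝 x := hρ.isOpen.mem_nhds hρ.mem

theorem contDiffAt (hρ : IsLocalDefiningFunction Ω x U ρ) : ContDiffAt ℝ ∞ ρ x :=
  hρ.smooth.contDiffAt hρ.mem_nhds

theorem contDiffAt_fderiv (hρ : IsLocalDefiningFunction Ω x U ρ) :
    ContDiffAt ℝ 1 (fderiv ℝ ρ) x :=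
  hρ.contDiffAt.fderiv_right (WithTop.coe_le_coe.2 le_top)

theorem hasFDerivAt (hρ : IsLocalDefiningFunction Ω x U ρ) : HasFDerivAt ρ (fderiv ℝ ρ x) x :=
  (hρ.contDiffAt.differentiableAt (by simp)).hasFDerivAt

theorem mem_iff (hρ : IsLocalDefiningFunction Ω x U ρ) (hy : y ∈ U) : y ∈ Ω ↔ ρ y < 0 := by
  simpa [hy] using Set.ext_iff.1 hρ.inter_eq y

theorem fderiv_gradient_pos (hρ : IsLocalDefiningFunction Ω x U ρ) :
    0 < fderiv ℝ ρ x (∇ ρ x) := by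
  rw [← inner_gradient_left]
  exact real_inner_self_pos.2 hρ.gradient_ne_zero

theorem eventually_isLocalDefiningFunction (hρ : IsLocalDefiningFunction Ω x U ρ) :
    ∀ᶠ y in 𝓝 x, IsLocalDefiningFunction Ω y U ρ := by
  have hcont : ContinuousAt (∇ ρ) x :=
    (InnerProductSpace.toDual ℝ (E d)).symm.continuous.continuousAt.comp
      hρ.contDiffAt_fderiv.continuousAt
  filter_upwards [hcont.eventually_ne hρ.gradient_ne_zero, hρ.mem_nhds] with y hne hy
  exact ⟨hρ.isOpen, hy, hρ.smooth, hne, hρ.inter_eq⟩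

theorem eventually_add_smul_mem (hρ : IsLocalDefiningFunction Ω x U ρ) (hx : ρ x = 0)
    (hu : fderiv ℝ ρ x u < 0) : ∀ᶠ s : ℝ in 𝓝[>] 0, x + s • u ∈ Ω := by
  have hslope := (hasDerivAt_comp_add_smul hρ.hasFDerivAt u).tendsto_slope_zero_right
  have hU : ∀ᶠ s : ℝ in 𝓝[>] 0, x + s • u ∈ U := by
    have hline : ContinuousAt (fun s : ℝ => x + s • u) 0 := by fun_prop
    exact (hline.eventually_mem (by simpa using hρ.mem_nhds)).filter_mono nhdsWithin_le_nhds
  filter_upwards [hU, hslope.eventually_lt_const hu, self_mem_nhdsWithin] with s hsU hneg hs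
  simp only [zero_add, zero_smul, add_zero, hx, sub_zero, smul_eq_mul] at hneg
  exact (hρ.mem_iff hsU).2 ((pos_iff_neg_of_mul_neg hneg).1 (inv_pos.2 hs))

theorem mem_frontier_iff (hρ : IsLocalDefiningFunction Ω x U ρ) : x ∈ frontier Ω ↔ ρ x = 0 := by
  have hcont : ContinuousAt ρ x := hρ.contDiffAt.continuousAt
  have hnear : ∀ᶠ y in 𝓝 x, y ∈ Ω ↔ ρ y < 0 :=
    eventually_of_mem hρ.mem_nhds fun y hy => hρ.mem_iff hy
  refine ⟨fun hx => le_antisymm ?_ ?_, fun hx => ⟨?_, fun hint => ?_⟩⟩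
  · refine not_lt.1 fun hpos => (mem_closure_iff_frequently.1 hx.1) ?_
    filter_upwards [hnear, hcont.eventually_const_lt hpos] with y hy hy0 hyΩ
    exact hy0.not_gt (hy.1 hyΩ)
  · refine not_lt.1 fun hneg => hx.2 (mem_interior_iff_mem_nhds.2 ?_)
    filter_upwards [hnear, hcont.eventually_lt_const hneg] with y hy hy0 using hy.2 hy0
  · have hinward := hρ.eventually_add_smul_mem (u := -∇ ρ x) hx (by
      rw [map_neg]
      exact neg_neg_of_pos hρ.fderiv_gradient_pos)
    have hline : Continuous fun s : ℝ => x + s • -∇ ρ x := by fun_prop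
    exact mem_closure_of_tendsto ((by simpa using hline.tendsto 0 :
      Tendsto _ (𝓝 (0 : ℝ)) (𝓝 x)).mono_left nhdsWithin_le_nhds) hinward
  · exact ((hρ.mem_iff hρ.mem).1 (interior_subset hint)).ne hx

-- If `y ∈ Ω` lay beyond the tangent hyperplane, then `x` would be in the open segment between `y`
-- and a point `x + s • (x - y)` of `Ω`.
theorem fderiv_sub_nonpos (hρ : IsLocalDefiningFunction Ω x U ρ) (hc : Convex ℝ Ω)
    (hx : x ∈ frontier Ω) (hy : y ∈ closure Ω) : fderiv ℝ ρ x (y - x) ≤ 0 := by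
  have hx0 := hρ.mem_frontier_iff.1 hx
  have hclosed : IsClosed {y : E d | fderiv ℝ ρ x (y - x) ≤ 0} :=
    isClosed_le (by fun_prop) continuous_const
  suffices hΩ : ∀ y ∈ Ω, fderiv ℝ ρ x (y - x) ≤ 0 from
    closure_minimal (fun y hyΩ => mem_ofPred.2 (hΩ y hyΩ)) hclosed hy
  refine fun y hyΩ => not_lt.1 fun hpos => ?_
  obtain ⟨s, hs, hsΩ⟩ := (eventually_mem_nhdsWithin.and <|
    hρ.eventually_add_smul_mem hx0 (u := x - y)
      (by rwa [← neg_sub, map_neg, neg_lt_zero])).exists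
  have hs : 0 < s := hs
  have hmem : x ∈ Ω := by
    convert hc hsΩ hyΩ (a := (1 + s)⁻¹) (b := s / (1 + s)) (by positivity) (by positivity)
      (by field_simp) using 1
    match_scalars <;> field_simp
    ring
  exact ((hρ.mem_iff hρ.mem).1 hmem).ne hx0

theorem exists_hasDerivAt_frontier (hρ : IsLocalDefiningFunction Ω x U ρ) (hx : x ∈ frontier Ω)
    (hw : fderiv ℝ ρ x w = 0) :
    ∃ z : ℝ → E d, z 0 = x ∧ HasDerivAt z w 0 ∧
      ∀ᶠ s in 𝓝 0, z s ∈ frontier Ω ∧ IsLocalDefiningFunction Ω (z s) U ρ := by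
  obtain ⟨z, hz0, hzw, hlevel⟩ := exists_hasDerivAt_levelSet
    (hρ.contDiffAt.hasStrictFDerivAt (by simp))
    (fun h => hρ.fderiv_gradient_pos.ne' (by simp [h])) hw
  have hz : Tendsto z (𝓝 0) (𝓝 x) := hz0 ▸ hzw.continuousAt.tendsto
  refine ⟨z, hz0, hzw, ?_⟩
  filter_upwards [hlevel, hz.eventually hρ.eventually_isLocalDefiningFunction] with s hs hρs
  exact ⟨hρs.mem_frontier_iff.2 (hs.trans (hρ.mem_frontier_iff.1 hx)), hρs⟩

-- By `fderiv_sub_nonpos`, `Dρ` is monotone along curves in the boundary.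
theorem fderiv_fderiv_nonneg (hρ : IsLocalDefiningFunction Ω x U ρ) (hc : Convex ℝ Ω)
    (hx : x ∈ frontier Ω) (hw : fderiv ℝ ρ x w = 0) : 0 ≤ fderiv ℝ (fderiv ℝ ρ) x w w := by
  obtain ⟨z, hz0, hzw, hz⟩ := hρ.exists_hasDerivAt_frontier hx hw
  have hDρ : HasDerivAt (fun s => fderiv ℝ ρ (z s)) (fderiv ℝ (fderiv ℝ ρ) x w) 0 :=
    (hρ.contDiffAt_fderiv.differentiableAt (by simp)).hasFDerivAt.comp_hasDerivAt_of_eq 0 hzw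
      hz0.symm
  have hprod := hDρ.tendsto_slope_zero_right.prodMk_nhds hzw.tendsto_slope_zero_right
  refine ge_of_tendsto ((isBoundedBilinearMap_apply.continuous.tendsto _).comp hprod) ?_
  filter_upwards [hz.filter_mono nhdsWithin_le_nhds] with s ⟨hsf, hρs⟩
  have hleft := hρs.fderiv_sub_nonpos hc hsf (frontier_subset_closure hx)
  have hright := hρ.fderiv_sub_nonpos hc hx (frontier_subset_closure hsf)
  simp only [Function.comp_apply, zero_add, hz0, smul_apply, map_smul, sub_apply, smul_eq_mul,
    ← mul_assoc]
  rw [← neg_sub, map_neg] at hleft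
  exact mul_nonneg (mul_self_nonneg _) (by linarith)

theorem isUnitOuterNormal (hρ : IsLocalDefiningFunction Ω x U ρ) :
    IsUnitOuterNormal Ω x (‖∇ ρ x‖⁻¹ • ∇ ρ x) := by
  have hpos : 0 < ‖∇ ρ x‖ := norm_pos_iff.2 hρ.gradient_ne_zero
  refine ⟨by rw [norm_smul, norm_inv, norm_norm, inv_mul_cancel₀ hpos.ne'], U, ρ, hρ, _, hpos, ?_⟩
  rw [smul_inv_smul₀ hpos.ne']

theorem hasFDerivAt_centeredGauge_nonpos (hρ : IsLocalDefiningFunction Ω x U ρ) (ho : IsOpen Ω)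
    (hc : Convex ℝ Ω) (hx₀ : x₀ ∈ Ω) (hx : x ∈ frontier Ω) {A : E d →L[ℝ] ℝ}
    (hA : HasFDerivAt (centeredGauge Ω x₀) A x) (hw : fderiv ℝ ρ x w ≤ 0) : A w ≤ 0 := by
  have hinward : ∀ u, fderiv ℝ ρ x u < 0 → A u ≤ 0 := fun u hu => by
    refine le_of_tendsto (hasDerivAt_comp_add_smul hA u).tendsto_slope_zero_right ?_
    filter_upwards [hρ.eventually_add_smul_mem (hρ.mem_frontier_iff.1 hx) hu, self_mem_nhdsWithin]
      with s hsΩ hs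
    have hlt := (centeredGauge_lt_one_iff ho hc hx₀).2 hsΩ
    simp only [zero_add, zero_smul, add_zero, (centeredGauge_eq_one_iff ho hc hx₀).2 hx]
    exact mul_nonpos_of_nonneg_of_nonpos (inv_nonneg.2 (le_of_lt hs)) (by linarith)
  have hlim : Tendsto (fun s : ℝ => A (w - s • ∇ ρ x)) (𝓝[>] 0) (𝓝 (A w)) := by
    have hcont : Continuous fun s : ℝ => A (w - s • ∇ ρ x) := by fun_prop
    simpa using (hcont.tendsto 0).mono_left nhdsWithin_le_nhds
  refine le_of_tendsto hlim (eventually_mem_nhdsWithin.mono fun s hs => hinward _ ?_)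
  rw [map_sub, map_smul, smul_eq_mul]
  linarith [mul_pos hs hρ.fderiv_gradient_pos]

end IsLocalDefiningFunction

theorem HasSmoothBoundary.isOutwardForGauge (hs : HasSmoothBoundary Ω) (ho : IsOpen Ω)
    (hc : Convex ℝ Ω) (hx₀ : x₀ ∈ Ω) {F : E d → E d}
    (hF : ∀ y ∈ frontier Ω, ∀ n, IsUnitOuterNormal Ω y n → 0 ≤ ⟪n, F y⟫_ℝ) :
    IsOutwardForGauge Ω x₀ F := by
  intro y hy A hA
  obtain ⟨U, ρ, hρ⟩ := hs y hy
  have hout := hF y hy _ hρ.isUnitOuterNormal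
  rw [real_inner_smul_left, inner_gradient_left] at hout
  have hpos : 0 ≤ fderiv ℝ ρ y (F y) :=
    nonneg_of_mul_nonneg_right hout (inv_pos.2 (norm_pos_iff.2 hρ.gradient_ne_zero))
  simpa using hρ.hasFDerivAt_centeredGauge_nonpos ho hc hx₀ hy hA (w := -F y) (by simpa using hpos)

/-- A nonempty bounded convex open set with smooth boundary. -/
structure IsSmoothConvexDomain (Ω : Set (E d)) : Prop where
  isOpen : IsOpen Ω
  isBounded : Bornology.IsBounded Ω
  convex : Convex ℝ Ω
  nonempty : Ω.Nonempty
  hasSmoothBoundary : HasSmoothBoundary Ω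

/-- The divergence of the vector field `F` within the set `S`. -/
noncomputable def divWithin {V : Type*} [NormedAddCommGroup V] [InnerProductSpace ℝ V]
    [FiniteDimensional ℝ V] (S : Set V) (F : V → V) (x : V) : ℝ :=
  traceCLM V (fderivWithin ℝ F S x)

namespace IsSmoothConvexDomain

theorem uniqueDiffOn (hΩ : IsSmoothConvexDomain Ω) : UniqueDiffOn ℝ (closure Ω) :=
  uniqueDiffOn_convex hΩ.convex.closure (hΩ.nonempty.mono hΩ.isOpen.subset_interior_closure)

theorem isCompact_closure (hΩ : IsSmoothConvexDomain Ω) : IsCompact (closure Ω) :=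
  hΩ.isBounded.isCompact_closure

theorem closure_mem_nhds (hΩ : IsSmoothConvexDomain Ω) (hx : x ∈ Ω) : closure Ω ∈ 𝓝 x :=
  mem_of_superset (hΩ.isOpen.mem_nhds hx) subset_closure

theorem integrableOn (hΩ : IsSmoothConvexDomain Ω) {F : Type*} [NormedAddCommGroup F]
    {f : E d → F} (hf : ContinuousOn f (closure Ω)) : IntegrableOn f Ω :=
  (hf.integrableOn_compact hΩ.isCompact_closure).mono_set subset_closure

theorem integral_divWithin_nonneg (hΩ : IsSmoothConvexDomain Ω) {F : E d → E d}
    (hF : ContDiffOn ℝ 1 F (closure Ω))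
    (hn : ∀ y ∈ frontier Ω, ∀ n, IsUnitOuterNormal Ω y n → 0 ≤ ⟪n, F y⟫_ℝ) :
    0 ≤ ∫ x in Ω, divWithin (closure Ω) F x := by
  obtain ⟨x₀, hx₀⟩ := hΩ.nonempty
  obtain ⟨K, hK⟩ := hF.exists_lipschitzOnWith one_ne_zero hΩ.convex.closure hΩ.isCompact_closure
  obtain ⟨G, hG, hGF⟩ := hK.extend_finite_dimension
  have hout : IsOutwardForGauge Ω x₀ G :=
    hΩ.hasSmoothBoundary.isOutwardForGauge hΩ.isOpen hΩ.convex hx₀ fun y hy =>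
      hGF (frontier_subset_closure hy) ▸ hn y hy
  refine (setIntegral_traceCLM_fderiv_nonneg hΩ.isOpen hΩ.isBounded hΩ.convex hx₀ hG hout).trans_eq
    (setIntegral_congr_fun hΩ.isOpen.measurableSet fun x hx => ?_)
  have hGx : G =ᶠ[𝓝 x] F :=
    eventually_of_mem (hΩ.closure_mem_nhds hx) fun y hy => (hGF hy).symm
  rw [divWithin, fderivWithin_of_mem_nhds (hΩ.closure_mem_nhds hx), hGx.fderiv_eq]

theorem integral_divWithin_eq_zero (hΩ : IsSmoothConvexDomain Ω) {F : E d → E d}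
    (hF : ContDiffOn ℝ 1 F (closure Ω))
    (hn : ∀ y ∈ frontier Ω, ∀ n, IsUnitOuterNormal Ω y n → ⟪n, F y⟫_ℝ = 0) :
    ∫ x in Ω, divWithin (closure Ω) F x = 0 := by
  have hneg := hΩ.integral_divWithin_nonneg hF.neg fun y hy n hyn => by
    rw [inner_neg_right, hn y hy n hyn, neg_zero]
  have hdiv : ∀ x ∈ Ω, divWithin (closure Ω) (fun x => -F x) x = -divWithin (closure Ω) F x :=
    fun x hx => by
      rw [divWithin, fderivWithin_fun_neg (hΩ.uniqueDiffOn x (subset_closure hx)), map_neg,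
        divWithin]
  rw [setIntegral_congr_fun hΩ.isOpen.measurableSet hdiv, integral_neg, neg_nonneg] at hneg
  exact le_antisymm hneg (hΩ.integral_divWithin_nonneg hF fun y hy n hyn => (hn y hy n hyn).ge)

end IsSmoothConvexDomain
end Boundary

/-! ### Hessian, divergence and the Bochner identity -/

section VectorCalculus

/-- The Hessian of `f` within the set `S`, as an endomorphism. -/
noncomputable def hessWithin {V : Type*} [NormedAddCommGroup V] [InnerProductSpace ℝ V]
    [CompleteSpace V] (S : Set V) (f : V → ℝ) (x : V) : V →L[ℝ] V :=
  fderivWithin ℝ (gradientWithin f S) S x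

variable {V : Type*} [NormedAddCommGroup V] [InnerProductSpace ℝ V] {S : Set V} {f : V → ℝ} {x : V}

section Complete

variable [CompleteSpace V]

theorem contDiffOn_gradientWithin (hS : UniqueDiffOn ℝ S) {m n : WithTop ℕ∞}
    (hf : ContDiffOn ℝ n f S) (hmn : m + 1 ≤ n) : ContDiffOn ℝ m (gradientWithin f S) S :=
  (InnerProductSpace.toDual ℝ V).symm.contDiff.comp_contDiffOn (hf.fderivWithin hS hmn)

theorem contDiffOn_hessWithin (hS : UniqueDiffOn ℝ S) {m n : WithTop ℕ∞}
    (hf : ContDiffOn ℝ n f S) (hmn : m + 2 ≤ n) : ContDiffOn ℝ m (hessWithin S f) S :=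
  (contDiffOn_gradientWithin hS hf (m := m + 1)
    (by rwa [add_assoc, one_add_one_eq_two])).fderivWithin hS le_rfl

theorem inner_hessWithin_left (hS : UniqueDiffOn ℝ S) (hx : x ∈ S) (a b : V) :
    ⟪hessWithin S f x a, b⟫_ℝ = fderivWithin ℝ (fderivWithin ℝ f S) S x a b := by
  have hcomp := (InnerProductSpace.toDual ℝ V).symm.toContinuousLinearEquiv.comp_fderivWithin
    (f := fderivWithin ℝ f S) (hS x hx)
  change ⟪fderivWithin ℝ ((InnerProductSpace.toDual ℝ V).symm.toContinuousLinearEquiv ∘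
    fderivWithin ℝ f S) S x a, b⟫_ℝ = _
  rw [hcomp]
  exact InnerProductSpace.toDual_symm_apply

theorem isSymmetric_hessWithin (hS : UniqueDiffOn ℝ S) (hx : x ∈ S)
    (hxi : x ∈ closure (interior S)) (hf : ContDiffOn ℝ 2 f S) :
    (hessWithin S f x : V →ₗ[ℝ] V).IsSymmetric := fun a b =>
  calc ⟪hessWithin S f x a, b⟫_ℝ
      = fderivWithin ℝ (fderivWithin ℝ f S) S x a b := inner_hessWithin_left hS hx a b
    _ = fderivWithin ℝ (fderivWithin ℝ f S) S x b a :=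
        (hf x hx).isSymmSndFDerivWithinAt (by simp) hS hxi hx a b
    _ = ⟪hessWithin S f x b, a⟫_ℝ := (inner_hessWithin_left hS hx b a).symm
    _ = ⟪a, hessWithin S f x b⟫_ℝ := real_inner_comm _ _

end Complete

variable [FiniteDimensional ℝ V]

theorem traceCLM_hessWithin (hS : UniqueDiffOn ℝ S) (hx : x ∈ S) :
    traceCLM V (hessWithin S f x) = (Δ[S] f) x := by
  rw [traceCLM_eq_sum_inner (stdOrthonormalBasis ℝ V),
    InnerProductSpace.laplacianWithin_eq_iteratedFDerivWithin_stdOrthonormalBasis f hS hx]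
  refine Finset.sum_congr rfl fun i _ => ?_
  rw [real_inner_comm, inner_hessWithin_left hS hx, iteratedFDerivWithin_two_apply _ hS hx]
  rfl

theorem divWithin_gradientWithin (hS : UniqueDiffOn ℝ S) (hx : x ∈ S) :
    divWithin S (gradientWithin f S) x = (Δ[S] f) x :=
  traceCLM_hessWithin hS hx

theorem contDiffOn_laplacianWithin (hS : UniqueDiffOn ℝ S) {m n : WithTop ℕ∞}
    (hf : ContDiffOn ℝ n f S) (hmn : m + 2 ≤ n) : ContDiffOn ℝ m (Δ[S] f) S :=
  ((traceCLM V).contDiff.comp_contDiffOn (contDiffOn_hessWithin hS hf hmn)).congr fun _ hx =>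
    (traceCLM_hessWithin hS hx).symm

theorem divWithin_smul (hS : UniqueDiffOn ℝ S) (hx : x ∈ S) {G : V → V}
    (hf : DifferentiableOn ℝ f S) (hG : DifferentiableOn ℝ G S) :
    divWithin S (fun y => f y • G y) x = fderivWithin ℝ f S x (G x) + f x * divWithin S G x := by
  rw [divWithin, fderivWithin_fun_smul (hS x hx) (hf x hx) (hG x hx), map_add, map_smul, add_comm]
  congr 1
  exact LinearMap.trace_smulRight _ _

-- `D(D²v)` is symmetric, being the second derivative of the vector field `∇v`; so contracting it
-- with `∇v` in either slot gives the derivative of `Δv = tr D²v` in the direction `∇v`.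
theorem divWithin_hessWithin_gradientWithin (hS : UniqueDiffOn ℝ S) (hx : x ∈ S)
    (hxi : x ∈ closure (interior S)) (hf : ContDiffOn ℝ 3 f S) :
    divWithin S (fun y => hessWithin S f y (gradientWithin f S y)) x =
      traceCLM V (hessWithin S f x ∘L hessWithin S f x) +
        fderivWithin ℝ (Δ[S] f) S x (gradientWithin f S x) := by
  have hgrad : ContDiffOn ℝ 2 (gradientWithin f S) S :=
    contDiffOn_gradientWithin hS hf (by norm_num)
  have hhess : DifferentiableWithinAt ℝ (hessWithin S f) S x :=
    (contDiffOn_hessWithin hS hf (m := 1) (by norm_num)).differentiableOn (by simp) x hx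
  have hsymm : (fderivWithin ℝ (hessWithin S f) S x).flip (gradientWithin f S x) =
      fderivWithin ℝ (hessWithin S f) S x (gradientWithin f S x) :=
    ContinuousLinearMap.ext fun a => (hgrad x hx).isSymmSndFDerivWithinAt (by simp) hS hxi hx _ _
  have hlap : fderivWithin ℝ (Δ[S] f) S x =
      traceCLM V ∘L fderivWithin ℝ (hessWithin S f) S x := by
    have hcomp : (Δ[S] f) =ᶠ[𝓝[S] x] traceCLM V ∘ hessWithin S f :=
      eventually_mem_nhdsWithin.mono fun y hy => (traceCLM_hessWithin hS hy).symm
    rw [hcomp.fderivWithin_eq_of_mem hx]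
    exact ((traceCLM V).hasFDerivAt.comp_hasFDerivWithinAt x
      hhess.hasFDerivWithinAt).fderivWithin (hS x hx)
  rw [divWithin, fderivWithin_clm_apply (hS x hx) hhess
    (hgrad.differentiableOn (by simp) x hx), hsymm, map_add, hlap]
  rfl

theorem divWithin_bochner (hS : UniqueDiffOn ℝ S) (hx : x ∈ S)
    (hxi : x ∈ closure (interior S)) (hf : ContDiffOn ℝ 3 f S) :
    divWithin S (fun y => (Δ[S] f) y • gradientWithin f S y -
        hessWithin S f y (gradientWithin f S y)) x =
      (Δ[S] f) x ^ 2 - traceCLM V (hessWithin S f x ∘L hessWithin S f x) := by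
  have hgrad : DifferentiableOn ℝ (gradientWithin f S) S :=
    (contDiffOn_gradientWithin hS hf (m := 1) (by norm_num)).differentiableOn (by simp)
  have hlap : DifferentiableOn ℝ (Δ[S] f) S :=
    (contDiffOn_laplacianWithin hS hf (m := 1) (by norm_num)).differentiableOn (by simp)
  have hhess : DifferentiableOn ℝ (hessWithin S f) S :=
    (contDiffOn_hessWithin hS hf (m := 1) (by norm_num)).differentiableOn (by simp)
  calc divWithin S (fun y => (Δ[S] f) y • gradientWithin f S y -
        hessWithin S f y (gradientWithin f S y)) x
      = divWithin S (fun y => (Δ[S] f) y • gradientWithin f S y) x -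
          divWithin S (fun y => hessWithin S f y (gradientWithin f S y)) x := by
        rw [divWithin, fderivWithin_fun_sub (hS x hx) ((hlap x hx).fun_smul (hgrad x hx))
          ((hhess x hx).clm_apply (hgrad x hx)), map_sub]
        rfl
    _ = (Δ[S] f) x ^ 2 - traceCLM V (hessWithin S f x ∘L hessWithin S f x) := by
        rw [divWithin_smul hS hx hlap hgrad, divWithin_gradientWithin hS hx,
          divWithin_hessWithin_gradientWithin hS hx hxi hf]
        ring

end VectorCalculus

/-! ### Integration by parts under the Neumann condition -/

section Neumann

variable {d : ℕ} {Ω U : Set (E d)} {v f ρ : E d → ℝ} {x y n : E d}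

theorem NeumannCondition.inner_gradientWithin (hv : NeumannCondition Ω v) (hy : y ∈ frontier Ω)
    (hn : IsUnitOuterNormal Ω y n) : ⟪n, gradientWithin v (closure Ω) y⟫_ℝ = 0 := by
  rw [real_inner_comm, inner_gradientWithin_left]
  exact hv y hy n hn

theorem NeumannCondition.fderiv_gradientWithin (hv : NeumannCondition Ω v) (hy : y ∈ frontier Ω)
    (hρ : IsLocalDefiningFunction Ω y U ρ) :
    fderiv ℝ ρ y (gradientWithin v (closure Ω) y) = 0 := by
  have hnormal := hv.inner_gradientWithin hy hρ.isUnitOuterNormal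
  rw [real_inner_smul_left, inner_gradient_left] at hnormal
  exact (mul_eq_zero.1 hnormal).resolve_left (inv_ne_zero (norm_ne_zero_iff.2 hρ.gradient_ne_zero))

namespace IsSmoothConvexDomain

theorem mem_closure_interior (hΩ : IsSmoothConvexDomain Ω) (hx : x ∈ closure Ω) :
    x ∈ closure (interior (closure Ω)) :=
  closure_mono hΩ.isOpen.subset_interior_closure hx

theorem integral_fderivWithin_add_mul_laplacianWithin (hΩ : IsSmoothConvexDomain Ω)
    (hv : NeumannCondition Ω v) (hv2 : ContDiffOn ℝ 2 v (closure Ω))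
    (hf : ContDiffOn ℝ 1 f (closure Ω)) :
    ∫ x in Ω, (fderivWithin ℝ f (closure Ω) x (gradientWithin v (closure Ω) x) +
      f x * (Δ[closure Ω] v) x) = 0 := by
  have hgrad : ContDiffOn ℝ 1 (gradientWithin v (closure Ω)) (closure Ω) :=
    contDiffOn_gradientWithin hΩ.uniqueDiffOn hv2 (by norm_num)
  rw [← hΩ.integral_divWithin_eq_zero (hf.smul hgrad) fun y hy n hn => by
    rw [Pi.smul_apply', real_inner_smul_right, hv.inner_gradientWithin hy hn, mul_zero]]
  refine setIntegral_congr_fun hΩ.isOpen.measurableSet fun x hx => ?_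
  have hxc := subset_closure hx
  exact ((divWithin_smul hΩ.uniqueDiffOn hxc (hf.differentiableOn (by simp))
    (hgrad.differentiableOn (by simp))).trans
      (by rw [divWithin_gradientWithin hΩ.uniqueDiffOn hxc])).symm

-- Differentiate `Dρ(∇v) = 0` along a boundary curve with tangent `∇v`; since `Ω` is convex,
-- `D²ρ(∇v, ∇v) ≥ 0`.
theorem inner_hessWithin_gradientWithin_nonpos (hΩ : IsSmoothConvexDomain Ω)
    (hv : NeumannCondition Ω v) (hv2 : ContDiffOn ℝ 2 v (closure Ω)) (hy : y ∈ frontier Ω)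
    (hn : IsUnitOuterNormal Ω y n) :
    ⟪n, hessWithin (closure Ω) v y (gradientWithin v (closure Ω) y)⟫_ℝ ≤ 0 := by
  obtain ⟨-, U, ρ, hρ, c, hc, hρn⟩ := hn
  set w := gradientWithin v (closure Ω) y
  have hw : fderiv ℝ ρ y w = 0 := hv.fderiv_gradientWithin hy hρ
  obtain ⟨z, hz0, hzw, hz⟩ := hρ.exists_hasDerivAt_frontier hy hw
  have hgrad : HasDerivAt (fun s => gradientWithin v (closure Ω) (z s))
      (hessWithin (closure Ω) v y w) 0 :=
    (((contDiffOn_gradientWithin hΩ.uniqueDiffOn hv2 (m := 1) (by norm_num)).differentiableOn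
      (by simp) y (frontier_subset_closure hy)).hasFDerivWithinAt).comp_hasDerivAt_of_eq 0 hzw
      (hz.mono fun s hs => frontier_subset_closure hs.1) hz0.symm
  have hDρ : HasDerivAt (fun s => fderiv ℝ ρ (z s)) (fderiv ℝ (fderiv ℝ ρ) y w) 0 :=
    (hρ.contDiffAt_fderiv.differentiableAt (by simp)).hasFDerivAt.comp_hasDerivAt_of_eq 0 hzw
      hz0.symm
  have hderiv : fderiv ℝ (fderiv ℝ ρ) y w w + fderiv ℝ ρ y (hessWithin (closure Ω) v y w) = 0 := by
    have hzero : HasDerivAt (fun s => fderiv ℝ ρ (z s) (gradientWithin v (closure Ω) (z s))) 0 0 :=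
      (hasDerivAt_const (0 : ℝ) (0 : ℝ)).congr_of_eventuallyEq
        (hz.mono fun s hs => hv.fderiv_gradientWithin hs.1 hs.2)
    simpa only [hz0] using (hDρ.clm_apply hgrad).unique hzero
  have hle : c * ⟪n, hessWithin (closure Ω) v y w⟫_ℝ ≤ 0 := by
    rw [← real_inner_smul_left, ← hρn, inner_gradient_left]
    linarith [hρ.fderiv_fderiv_nonneg hΩ.convex hy hw]
  exact nonpos_of_mul_nonpos_right hle hc

theorem integral_traceCLM_hessWithin_sq_le (hΩ : IsSmoothConvexDomain Ω)
    (hv : NeumannCondition Ω v) (hv3 : ContDiffOn ℝ 3 v (closure Ω)) :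
    ∫ x in Ω, traceCLM (E d) (hessWithin (closure Ω) v x ∘L hessWithin (closure Ω) v x) ≤
      ∫ x in Ω, (Δ[closure Ω] v) x ^ 2 := by
  have hgrad : ContDiffOn ℝ 1 (gradientWithin v (closure Ω)) (closure Ω) :=
    contDiffOn_gradientWithin hΩ.uniqueDiffOn hv3 (by norm_num)
  have hhess : ContDiffOn ℝ 1 (hessWithin (closure Ω) v) (closure Ω) :=
    contDiffOn_hessWithin hΩ.uniqueDiffOn hv3 (by norm_num)
  have hlap : ContDiffOn ℝ 1 (Δ[closure Ω] v) (closure Ω) :=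
    contDiffOn_laplacianWithin hΩ.uniqueDiffOn hv3 (by norm_num)
  have hdiv := hΩ.integral_divWithin_nonneg
    (F := fun x => (Δ[closure Ω] v) x • gradientWithin v (closure Ω) x -
      hessWithin (closure Ω) v x (gradientWithin v (closure Ω) x))
    ((hlap.smul hgrad).sub (hhess.clm_apply hgrad)) fun y hy n hn => by
      rw [inner_sub_right, real_inner_smul_right,
        hv.inner_gradientWithin hy hn, mul_zero, zero_sub, neg_nonneg]
      exact hΩ.inner_hessWithin_gradientWithin_nonpos hv (hv3.of_le (by norm_num)) hy hn
  have hint : IntegrableOn (fun x => traceCLM (E d)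
      (hessWithin (closure Ω) v x ∘L hessWithin (closure Ω) v x)) Ω :=
    hΩ.integrableOn ((traceCLM (E d)).continuous.comp_continuousOn
      (hhess.continuousOn.clm_comp hhess.continuousOn))
  rw [setIntegral_congr_fun hΩ.isOpen.measurableSet fun x hx =>
      divWithin_bochner hΩ.uniqueDiffOn (subset_closure hx)
        (hΩ.mem_closure_interior (subset_closure hx)) hv3,
    integral_sub (hΩ.integrableOn (hlap.continuousOn.fun_pow 2)) hint] at hdiv
  exact sub_nonneg.1 hdiv

end IsSmoothConvexDomain
end Neumann

/-! ### The Poincaré inequality -/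

section Poincare

variable {d : ℕ} {Ω : Set (E d)} {u v : E d → ℝ} {x : E d}

theorem gradientWithin_of_mem_nhds {V : Type*} [NormedAddCommGroup V] [InnerProductSpace ℝ V]
    [CompleteSpace V] {S : Set V} {x : V} (hS : S ∈ 𝓝 x) (f : V → ℝ) :
    gradientWithin f S x = ∇ f x := by
  rw [gradientWithin, fderivWithin_of_mem_nhds hS, gradient]

theorem gradientWithin_sub_const {V : Type*} [NormedAddCommGroup V] [InnerProductSpace ℝ V]
    [CompleteSpace V] (f : V → ℝ) (S : Set V) (c : ℝ) :
    gradientWithin (fun x => f x - c) S = gradientWithin f S := by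
  ext1 x
  rw [gradientWithin, fderivWithin_sub_const, gradientWithin]

theorem integral_add_mul_sq {α : Type*} {_ : MeasurableSpace α} {μ : Measure α} {f g : α → ℝ}
    (hf : Integrable (fun x => f x ^ 2) μ) (hfg : Integrable (fun x => f x * g x) μ)
    (hg : Integrable (fun x => g x ^ 2) μ) (c : ℝ) :
    ∫ x, (f x + c * g x) ^ 2 ∂μ =
      (∫ x, f x ^ 2 ∂μ) + 2 * c * (∫ x, f x * g x ∂μ) + c ^ 2 * ∫ x, g x ^ 2 ∂μ := by
  rw [← integral_const_mul, ← integral_const_mul, ← integral_add hf (hfg.const_mul _),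
    ← integral_add (hf.fun_add (hfg.const_mul _)) (hg.const_mul _)]
  exact integral_congr_ae (ae_of_all _ fun x => by ring)

theorem lambda2_nonneg (Ω : Set (E d)) : 0 ≤ lambda2 Ω := by
  refine Real.sInf_nonneg ?_
  rintro r ⟨u, G, -, -, -, rfl⟩
  positivity

namespace IsSmoothConvexDomain

theorem continuousOn_gradientWithin (hΩ : IsSmoothConvexDomain Ω)
    (hu : ContDiffOn ℝ 1 u (closure Ω)) :
    ContinuousOn (gradientWithin u (closure Ω)) (closure Ω) :=
  (contDiffOn_gradientWithin (m := 0) hΩ.uniqueDiffOn hu (by norm_num)).continuousOn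

theorem memLp_two (hΩ : IsSmoothConvexDomain Ω) {F : Type*} [NormedAddCommGroup F]
    {f : E d → F} (hf : ContinuousOn f (closure Ω)) : MemLp f 2 (volume.restrict Ω) :=
  (memLp_two_iff_integrable_sq_norm (hΩ.integrableOn hf).aestronglyMeasurable).2
    (hΩ.integrableOn (hf.norm.pow 2))

theorem integral_fderivWithin_eq_zero (hΩ : IsSmoothConvexDomain Ω)
    (hu : ContDiffOn ℝ 1 u (closure Ω)) (h0 : ∀ y ∈ frontier Ω, u y = 0) (w : E d) :
    ∫ x in Ω, fderivWithin ℝ u (closure Ω) x w = 0 := by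
  rw [← hΩ.integral_divWithin_eq_zero (F := fun x => u x • w) (hu.smul contDiffOn_const)
    fun y hy n _ => by rw [h0 y hy, zero_smul, inner_zero_right]]
  refine setIntegral_congr_fun hΩ.isOpen.measurableSet fun x hx => ?_
  have hdiv := divWithin_smul hΩ.uniqueDiffOn (subset_closure hx) (G := fun _ => w)
    (hu.differentiableOn (by simp)) (differentiableOn_const w)
  simpa [divWithin] using hdiv.symm

theorem memH1 (hΩ : IsSmoothConvexDomain Ω) (hu : ContDiffOn ℝ 1 u (closure Ω)) :
    MemH1 Ω u (gradientWithin u (closure Ω)) := by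
  have hgrad := hΩ.continuousOn_gradientWithin hu
  refine ⟨hΩ.memLp_two hu.continuousOn, hΩ.memLp_two hgrad, fun φ hφ _ hφΩ => ?_⟩
  have hφ1 : ContDiff ℝ 1 φ := hφ.of_le (by exact_mod_cast le_top)
  have hφgrad : Continuous (∇ φ) :=
    (InnerProductSpace.toDual ℝ (E d)).symm.continuous.comp (hφ1.continuous_fderiv (by simp))
  have hint₁ : IntegrableOn (fun x => u x • ∇ φ x) Ω :=
    hΩ.integrableOn (hu.continuousOn.smul hφgrad.continuousOn)
  have hint₂ : IntegrableOn (fun x => φ x • gradientWithin u (closure Ω) x) Ω :=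
    hΩ.integrableOn (hφ1.continuous.continuousOn.smul hgrad)
  have hzero : ∀ y ∈ frontier Ω, u y * φ y = 0 := fun y hy => by
    rw [image_eq_zero_of_notMem_tsupport fun h =>
      (hΩ.isOpen.frontier_eq ▸ hy : y ∈ closure Ω \ Ω).2 (hφΩ h), mul_zero]
  rw [eq_neg_iff_add_eq_zero, ← integral_add hint₁ hint₂]
  refine ext_inner_left ℝ fun w => ?_
  rw [← integral_inner (hint₁.fun_add hint₂), inner_zero_right,
    ← hΩ.integral_fderivWithin_eq_zero (hu.mul hφ1.contDiffOn) hzero w]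
  refine setIntegral_congr_fun hΩ.isOpen.measurableSet fun x hx => ?_
  have hxc := subset_closure hx
  rw [fderivWithin_fun_mul (hΩ.uniqueDiffOn x hxc) (hu.differentiableOn (by simp) x hxc)
    (hφ1.differentiable (by simp) x).differentiableWithinAt, inner_add_right,
    real_inner_smul_right, real_inner_smul_right, real_inner_comm, inner_gradient_left,
    real_inner_comm, inner_gradientWithin_left, fderivWithin_of_mem_nhds (hΩ.closure_mem_nhds hx),
    fderivWithin_of_mem_nhds (hΩ.closure_mem_nhds hx)]
  rfl

theorem lambda2_mul_integral_sq_le (hΩ : IsSmoothConvexDomain Ω)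
    (hu : ContDiffOn ℝ 1 u (closure Ω)) (h0 : ∫ x in Ω, u x = 0) :
    lambda2 Ω * ∫ x in Ω, u x ^ 2 ≤ ∫ x in Ω, ‖gradientWithin u (closure Ω) x‖ ^ 2 := by
  rcases (integral_nonneg fun x => sq_nonneg (u x) : 0 ≤ ∫ x in Ω, u x ^ 2).eq_or_lt' with h | h
  · rw [h, mul_zero]
    positivity
  · rw [← le_div_iff₀ h]
    refine csInf_le ⟨0, ?_⟩ ⟨u, gradientWithin u (closure Ω), hΩ.memH1 hu, h0, h, rfl⟩
    rintro r ⟨u, G, -, -, -, rfl⟩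
    positivity

-- Apply the Poincaré inequality to `v - ⨍ v` and expand `0 ≤ ∫ (Δv + λ₂ (v - ⨍ v))²`.
theorem lambda2_mul_integral_norm_gradientWithin_sq_le (hΩ : IsSmoothConvexDomain Ω)
    (hv : NeumannCondition Ω v) (hv2 : ContDiffOn ℝ 2 v (closure Ω)) :
    lambda2 Ω * ∫ x in Ω, ‖gradientWithin v (closure Ω) x‖ ^ 2 ≤
      ∫ x in Ω, (Δ[closure Ω] v) x ^ 2 := by
  have hv1 : ContDiffOn ℝ 1 v (closure Ω) := hv2.of_le (by norm_num)
  set w := fun x => v x - ⨍ y in Ω, v y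
  have hw : ContDiffOn ℝ 1 w (closure Ω) := hv1.sub contDiffOn_const
  have hwgrad : gradientWithin w (closure Ω) = gradientWithin v (closure Ω) :=
    gradientWithin_sub_const v _ _
  have hlap : ContinuousOn (Δ[closure Ω] v) (closure Ω) :=
    (contDiffOn_laplacianWithin (m := 0) hΩ.uniqueDiffOn hv2 (by norm_num)).continuousOn
  have : IsFiniteMeasure (volume.restrict Ω) := ⟨by simpa using hΩ.isBounded.measure_lt_top⟩
  have hpoincare := hΩ.lambda2_mul_integral_sq_le hw (integral_sub_average _ v)
  have hparts : (∫ x in Ω, ‖gradientWithin v (closure Ω) x‖ ^ 2) +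
      ∫ x in Ω, (Δ[closure Ω] v) x * w x = 0 := by
    rw [← integral_add (hΩ.integrableOn ((hΩ.continuousOn_gradientWithin hv1).norm.fun_pow 2))
      (hΩ.integrableOn (hlap.fun_mul hw.continuousOn)),
      ← hΩ.integral_fderivWithin_add_mul_laplacianWithin hv hv2 hw]
    refine integral_congr_ae (ae_of_all _ fun x => ?_)
    simp only [← inner_gradientWithin_left, hwgrad, real_inner_self_eq_norm_sq, mul_comm]
  have hsq : 0 ≤ ∫ x in Ω, ((Δ[closure Ω] v) x + lambda2 Ω * w x) ^ 2 := by positivity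
  rw [integral_add_mul_sq (hΩ.integrableOn (hlap.pow 2))
    (hΩ.integrableOn (hlap.mul hw.continuousOn)) (hΩ.integrableOn (hw.continuousOn.pow 2)),
    eq_neg_of_add_eq_zero_right hparts] at hsq
  rw [hwgrad] at hpoincare
  linarith [mul_le_mul_of_nonneg_left hpoincare (lambda2_nonneg Ω)]

end IsSmoothConvexDomain
end Poincare

/-! ### Trace inequalities -/

section Trace

open Module InnerProductSpace

variable {V : Type*} [NormedAddCommGroup V] [InnerProductSpace ℝ V] [FiniteDimensional ℝ V]
  {T : V →L[ℝ] V}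

theorem traceCLM_comp_comm (S T : V →L[ℝ] V) : traceCLM V (S ∘L T) = traceCLM V (T ∘L S) :=
  LinearMap.trace_mul_comm ℝ (S : V →ₗ[ℝ] V) T

theorem traceCLM_comp_rankOne (T : V →L[ℝ] V) (x y : V) :
    traceCLM V (T ∘L rankOne ℝ x y) = ⟪y, T x⟫_ℝ := by
  rw [comp_rankOne]
  exact trace_rankOne (T x) y

theorem traceCLM_comp_self_eq_sum_norm_sq {ι : Type*} [Fintype ι] (b : OrthonormalBasis ι ℝ V)
    (hT : (T : V →ₗ[ℝ] V).IsSymmetric) : traceCLM V (T ∘L T) = ∑ i, ‖T (b i)‖ ^ 2 := by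
  rw [traceCLM_eq_sum_inner b]
  exact Finset.sum_congr rfl fun i _ =>
    (hT (b i) (T (b i))).symm.trans (real_inner_self_eq_norm_sq _)

theorem sq_traceCLM_le (hT : (T : V →ₗ[ℝ] V).IsSymmetric) :
    traceCLM V T ^ 2 ≤ finrank ℝ V * traceCLM V (T ∘L T) := by
  set b := stdOrthonormalBasis ℝ V
  have hdiag : ∀ i, ⟪b i, T (b i)⟫_ℝ ^ 2 ≤ ‖T (b i)‖ ^ 2 := fun i => by
    rw [sq_le_sq, abs_norm]
    simpa using abs_real_inner_le_norm (b i) (T (b i))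
  calc traceCLM V T ^ 2 = (∑ i, ⟪b i, T (b i)⟫_ℝ) ^ 2 := by rw [traceCLM_eq_sum_inner b]
    _ ≤ finrank ℝ V * ∑ i, ⟪b i, T (b i)⟫_ℝ ^ 2 := by
        simpa using sq_sum_le_card_mul_sum_sq (s := Finset.univ) (f := fun i => ⟪b i, T (b i)⟫_ℝ)
    _ ≤ finrank ℝ V * ∑ i, ‖T (b i)‖ ^ 2 :=
        mul_le_mul_of_nonneg_left (Finset.sum_le_sum fun i _ => hdiag i) (by positivity)
    _ = finrank ℝ V * traceCLM V (T ∘L T) := by rw [traceCLM_comp_self_eq_sum_norm_sq b hT]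

theorem sq_traceCLM_sub_le (hT : (T : V →ₗ[ℝ] V).IsSymmetric) (w : V) (γ : ℝ) :
    (traceCLM V T - γ * ‖w‖ ^ 2) ^ 2 ≤ finrank ℝ V *
      (traceCLM V (T ∘L T) - 2 * γ * ⟪w, T w⟫_ℝ + γ ^ 2 * ‖w‖ ^ 4) := by
  set P := rankOne ℝ w w
  have hP : traceCLM V P = ‖w‖ ^ 2 := (trace_rankOne w w).trans (real_inner_self_eq_norm_sq w)
  have hPP : traceCLM V (P ∘L P) = ‖w‖ ^ 4 := by
    rw [traceCLM_comp_rankOne, rankOne_apply, real_inner_smul_right, real_inner_self_eq_norm_sq]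
    ring
  have hsymm : ((T - γ • P : V →L[ℝ] V) : V →ₗ[ℝ] V).IsSymmetric :=
    hT.sub ((isSymmetric_rankOne_self w).smul (by simp))
  have hle := sq_traceCLM_le hsymm
  simp only [ContinuousLinearMap.sub_comp, ContinuousLinearMap.comp_sub,
    ContinuousLinearMap.smul_comp, ContinuousLinearMap.comp_smul, map_sub, map_smul, smul_eq_mul,
    traceCLM_comp_comm P T, hPP, hP, P, traceCLM_comp_rankOne] at hle
  convert hle using 2
  ring

theorem inner_apply_self_of_finrank_eq_one (hV : finrank ℝ V = 1) (T : V →L[ℝ] V) (w : V) :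
    ⟪w, T w⟫_ℝ = traceCLM V T * ‖w‖ ^ 2 := by
  obtain ⟨c, hc, -⟩ :=
    LinearMap.existsUnique_eq_smul_id_of_finrank_eq_one hV (T : V →ₗ[ℝ] V)
  have htrace : traceCLM V T = c := by
    change LinearMap.trace ℝ V (T : V →ₗ[ℝ] V) = c
    simp [hc, hV]
  have hw : T w = c • w := congr($hc w)
  rw [htrace, hw, real_inner_smul_right, real_inner_self_eq_norm_sq]

-- In dimension one the junk value `d / (d - 1) = 0` removes the second term. Otherwise the
-- difference of the two sides is a multiple of the defect in `sq_traceCLM_sub_le`, where `γ` is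
-- chosen to complete the square.
theorem constR_pointwise_le {θ : ℝ} (hθ : 0 < θ) (p β r : ℝ)
    (hT : (T : V →ₗ[ℝ] V).IsSymmetric) (w : V) :
    constR θ p (finrank ℝ V) β * (‖w‖ ^ 4 / r ^ 2) +
      θ * finrank ℝ V / (finrank ℝ V - 1) * (traceCLM V T ^ 2 - traceCLM V (T ∘L T)) +
      (kappa p β + β - 1) * (finrank ℝ V / (finrank ℝ V + 2)) *
        (2 * ⟪w, T w⟫_ℝ / r + ‖w‖ ^ 2 / r * traceCLM V T - ‖w‖ ^ 4 / r ^ 2) ≤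
    (traceCLM V T + (β - 1) * (‖w‖ ^ 2 / r)) * (traceCLM V T + kappa p β * (‖w‖ ^ 2 / r)) -
      (1 - θ) * traceCLM V T ^ 2 := by
  rw [constR, ← sub_nonneg]
  generalize kappa p β = κ
  set c := κ + β - 1 with hc
  rcases eq_or_ne (finrank ℝ V) 1 with hV | hV
  · rw [hV, inner_apply_self_of_finrank_eq_one hV]
    have : 0 ≤ θ * traceCLM V T ^ 2 := by positivity
    convert this using 1
    rw [hc]
    simp only [Nat.cast_one, sub_self, div_zero, zero_div]
    ring
  · set d := finrank ℝ V
    have hd1 : (d : ℝ) - 1 ≠ 0 := sub_ne_zero.2 (by exact_mod_cast hV)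
    have hsq := sub_nonneg.2 (sq_traceCLM_sub_le hT w (c * (d - 1) / (θ * (d + 2)) / r))
    set L := traceCLM V T
    set γ := c * (d - 1) / (θ * (d + 2)) / r with hγ
    have hdefect : 0 ≤ θ / (d - 1) * (d * (traceCLM V (T ∘L T) - 2 * γ * ⟪w, T w⟫_ℝ +
        γ ^ 2 * ‖w‖ ^ 4) - (L - γ * ‖w‖ ^ 2) ^ 2) := by
      rcases Nat.eq_zero_or_pos d with hd0 | hd0
      · simpa [hd0, div_neg] using mul_nonneg hθ.le (sq_nonneg (L - γ * ‖w‖ ^ 2))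
      · have : (1 : ℝ) ≤ d := by exact_mod_cast hd0
        exact mul_nonneg (div_nonneg hθ.le (by linarith)) hsq
    convert hdefect using 1
    rw [hγ, hc]
    have : (d : ℝ) + 2 ≠ 0 := by positivity
    simp only [div_eq_mul_inv _ r, div_eq_mul_inv _ (r ^ 2), ← inv_pow]
    generalize r⁻¹ = s
    field_simp
    ring

end Trace

/-! ### The entropy production estimate -/

section EntropyProduction

/-- The weighted Laplacian `f⁻ᶜ div (fᶜ ∇f) = Δf + c |∇f|² / f` of a positive function `f` within
the set `S`, in its expanded form. With `c = κ` it is the operator driving the flow, and with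
`c = q - 1` it gives `Δ(f ^ q)` up to the factor `q f ^ (q - 1)`. -/
noncomputable def weightedLaplacianWithin {V : Type*} [NormedAddCommGroup V]
    [InnerProductSpace ℝ V] [FiniteDimensional ℝ V] (S : Set V) (c : ℝ) (f : V → ℝ) (x : V) : ℝ :=
  (Δ[S] f) x + c * (‖gradientWithin f S x‖ ^ 2 / f x)

variable {d : ℕ} {Ω : Set (E d)} {v : E d → ℝ}

theorem fderivWithin_norm_gradientWithin_sq_div {V : Type*} [NormedAddCommGroup V]
    [InnerProductSpace ℝ V] [CompleteSpace V] {S : Set V} {v : V → ℝ} {x : V}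
    (hS : UniqueDiffOn ℝ S) (hx : x ∈ S) (hv : ContDiffOn ℝ 2 v S) (hvx : v x ≠ 0) :
    fderivWithin ℝ (fun y => ‖gradientWithin v S y‖ ^ 2 / v y) S x (gradientWithin v S x) =
      2 * ⟪gradientWithin v S x, hessWithin S v x (gradientWithin v S x)⟫_ℝ / v x -
        ‖gradientWithin v S x‖ ^ 4 / v x ^ 2 := by
  have hgrad : HasFDerivWithinAt (gradientWithin v S) (hessWithin S v x) S x :=
    ((contDiffOn_gradientWithin hS hv (m := 1) (by norm_num)).differentiableOn (by simp) x
      hx).hasFDerivWithinAt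
  have hinv : HasFDerivWithinAt (fun y => (v y)⁻¹) (-(v x ^ 2)⁻¹ • fderivWithin ℝ v S x) S x :=
    (hasDerivAt_inv hvx).comp_hasFDerivWithinAt x
      (hv.differentiableOn (by simp) x hx).hasFDerivWithinAt
  simp_rw [div_eq_mul_inv _ (v _)]
  rw [(hgrad.norm_sq.fun_mul hinv).fderivWithin (hS x hx)]
  simp only [smul_apply, add_apply, ContinuousLinearMap.comp_apply, innerSL_apply_apply,
    smul_eq_mul, nsmul_eq_mul, Nat.cast_ofNat, ← inner_gradientWithin_left,
    real_inner_self_eq_norm_sq]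
  field_simp
  ring

theorem continuousOn_weightedLaplacianWithin {V : Type*} [NormedAddCommGroup V]
    [InnerProductSpace ℝ V] [FiniteDimensional ℝ V] {S : Set V} {v : V → ℝ}
    (hS : UniqueDiffOn ℝ S) (hv : ContDiffOn ℝ 2 v S) (hne : ∀ x ∈ S, v x ≠ 0) (c : ℝ) :
    ContinuousOn (weightedLaplacianWithin S c v) S :=
  (contDiffOn_laplacianWithin (m := 0) hS hv (by norm_num)).continuousOn.add
    (continuousOn_const.mul (((contDiffOn_gradientWithin (m := 1) hS hv
      (by norm_num)).continuousOn.norm.pow 2).div hv.continuousOn hne))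

namespace IsSmoothConvexDomain

theorem integral_inner_hessWithin_div_eq_zero (hΩ : IsSmoothConvexDomain Ω)
    (hv : NeumannCondition Ω v) (hv2 : ContDiffOn ℝ 2 v (closure Ω))
    (hne : ∀ x ∈ closure Ω, v x ≠ 0) :
    ∫ x in Ω, (2 * ⟪gradientWithin v (closure Ω) x,
          hessWithin (closure Ω) v x (gradientWithin v (closure Ω) x)⟫_ℝ / v x +
        ‖gradientWithin v (closure Ω) x‖ ^ 2 / v x * (Δ[closure Ω] v) x -
        ‖gradientWithin v (closure Ω) x‖ ^ 4 / v x ^ 2) = 0 := by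
  have hquot : ContDiffOn ℝ 1 (fun x => ‖gradientWithin v (closure Ω) x‖ ^ 2 / v x) (closure Ω) :=
    ((contDiffOn_gradientWithin hΩ.uniqueDiffOn hv2 (by norm_num)).norm_sq ℝ).div
      (hv2.of_le (by norm_num)) hne
  rw [← hΩ.integral_fderivWithin_add_mul_laplacianWithin hv hv2 hquot]
  refine setIntegral_congr_fun hΩ.isOpen.measurableSet fun x hx => ?_
  have hxc := subset_closure hx
  simp only [fderivWithin_norm_gradientWithin_sq_div hΩ.uniqueDiffOn hxc hv2 (hne x hxc)]
  ring

theorem constR_mul_integral_add_le (hΩ : IsSmoothConvexDomain Ω) (hv : NeumannCondition Ω v)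
    (hv3 : ContDiffOn ℝ 3 v (closure Ω)) (hne : ∀ x ∈ closure Ω, v x ≠ 0) {θ : ℝ} (hθ : 0 < θ)
    (p β : ℝ) :
    constR θ p d β * (∫ x in Ω, ‖gradientWithin v (closure Ω) x‖ ^ 4 / v x ^ 2) +
      θ * d / (d - 1) * ((∫ x in Ω, (Δ[closure Ω] v) x ^ 2) -
        ∫ x in Ω, traceCLM (E d) (hessWithin (closure Ω) v x ∘L hessWithin (closure Ω) v x)) ≤
      (∫ x in Ω, weightedLaplacianWithin (closure Ω) (β - 1) v x *
        weightedLaplacianWithin (closure Ω) (kappa p β) v x) -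
      (1 - θ) * ∫ x in Ω, (Δ[closure Ω] v) x ^ 2 := by
  have hS := hΩ.uniqueDiffOn
  have hv2 : ContDiffOn ℝ 2 v (closure Ω) := hv3.of_le (by norm_num)
  have hdiv := hΩ.integral_inner_hessWithin_div_eq_zero hv hv2 hne
  have hvc := hv2.continuousOn
  have hgrad := hΩ.continuousOn_gradientWithin (hv2.of_le (by norm_num))
  have hhess := (contDiffOn_hessWithin (m := 1) hS hv3 (by norm_num)).continuousOn
  have hlap := (contDiffOn_laplacianWithin (m := 1) hS hv3 (by norm_num)).continuousOn
  set S := closure Ω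
  have hquot : ContinuousOn (fun x => ‖gradientWithin v S x‖ ^ 2 / v x) S :=
    (hgrad.norm.pow 2).div hvc hne
  have hquot₂ : ContinuousOn (fun x => ‖gradientWithin v S x‖ ^ 4 / v x ^ 2) S :=
    (hgrad.norm.pow 4).div (hvc.pow 2) fun x hx => pow_ne_zero 2 (hne x hx)
  have hlap_sq := hΩ.integrableOn (hlap.fun_pow 2)
  have htrace := hΩ.integrableOn
    ((traceCLM (E d)).continuous.comp_continuousOn' (hhess.clm_comp hhess))
  have hdiff := hlap_sq.fun_sub htrace
  have hsum := ((hΩ.integrableOn hquot₂).const_mul (constR θ p d β)).fun_add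
    (hdiff.const_mul (θ * d / (d - 1)))
  have hinner : ContinuousOn (fun x => 2 * ⟪gradientWithin v S x,
      hessWithin S v x (gradientWithin v S x)⟫_ℝ / v x) S :=
    (continuousOn_const.mul (hgrad.inner (hhess.clm_apply hgrad))).div hvc hne
  have hdivInt := hΩ.integrableOn ((hinner.fun_add (hquot.fun_mul hlap)).fun_sub hquot₂)
  have hprod := hΩ.integrableOn ((continuousOn_weightedLaplacianWithin hS hv2 hne (β - 1)).fun_mul
    (continuousOn_weightedLaplacianWithin hS hv2 hne (kappa p β)))
  have hmono := setIntegral_mono_on (hsum.fun_add (hdivInt.const_mul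
    ((kappa p β + β - 1) * (d / (d + 2))))) (hprod.fun_sub (hlap_sq.const_mul (1 - θ)))
    hΩ.isOpen.measurableSet fun x hx => by
      have hxc := subset_closure hx
      simpa only [finrank_euclideanSpace_fin, traceCLM_hessWithin hS hxc,
        weightedLaplacianWithin] using
        constR_pointwise_le hθ p β (v x)
          (isSymmetric_hessWithin hS hxc (hΩ.mem_closure_interior hxc) hv2) (gradientWithin v S x)
  rwa [integral_add hsum (hdivInt.const_mul _), integral_add ((hΩ.integrableOn hquot₂).const_mul _)
    (hdiff.const_mul _), integral_sub hprod (hlap_sq.const_mul _), integral_const_mul,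
    integral_const_mul, integral_const_mul, integral_const_mul, hdiv,
    integral_sub hlap_sq htrace, mul_zero, add_zero] at hmono

theorem constR_mul_integral_le (hΩ : IsSmoothConvexDomain Ω) (hv : NeumannCondition Ω v)
    (hv3 : ContDiffOn ℝ 3 v (closure Ω)) (hne : ∀ x ∈ closure Ω, v x ≠ 0) {θ Λ : ℝ} (hθ0 : 0 < θ)
    (hθ1 : θ ≤ 1) (p β : ℝ) (hΛ : Λ ≤ (1 - θ) * lambda2 Ω) :
    constR θ p d β * ∫ x in Ω, ‖gradientWithin v (closure Ω) x‖ ^ 4 / v x ^ 2 ≤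
      (∫ x in Ω, weightedLaplacianWithin (closure Ω) (β - 1) v x *
        weightedLaplacianWithin (closure Ω) (kappa p β) v x) -
      Λ * ∫ x in Ω, ‖gradientWithin v (closure Ω) x‖ ^ 2 := by
  have hgap : Λ * ∫ x in Ω, ‖gradientWithin v (closure Ω) x‖ ^ 2 ≤
      (1 - θ) * ∫ x in Ω, (Δ[closure Ω] v) x ^ 2 := by
    calc Λ * ∫ x in Ω, ‖gradientWithin v (closure Ω) x‖ ^ 2
        ≤ (1 - θ) * lambda2 Ω * ∫ x in Ω, ‖gradientWithin v (closure Ω) x‖ ^ 2 := by gcongr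
      _ = (1 - θ) * (lambda2 Ω * ∫ x in Ω, ‖gradientWithin v (closure Ω) x‖ ^ 2) := mul_assoc _ _ _
      _ ≤ (1 - θ) * ∫ x in Ω, (Δ[closure Ω] v) x ^ 2 :=
          mul_le_mul_of_nonneg_left (hΩ.lambda2_mul_integral_norm_gradientWithin_sq_le hv
            (hv3.of_le (by norm_num))) (sub_nonneg.2 hθ1)
  have hcoef : 0 ≤ θ * d / ((d : ℝ) - 1) := by
    rcases Nat.eq_zero_or_pos d with rfl | hd
    · simp
    · exact div_nonneg (by positivity) (sub_nonneg.2 (by exact_mod_cast hd))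
  have hbochner := mul_nonneg hcoef (sub_nonneg.2 (hΩ.integral_traceCLM_hessWithin_sq_le hv hv3))
  linarith [hΩ.constR_mul_integral_add_le hv hv3 hne hθ0 p β]

end IsSmoothConvexDomain
end EntropyProduction

/-! ### Differentiation under the integral sign -/

section ParametricIntegral

variable {X : Type*} [MeasurableSpace X] {μ : Measure X} [IsFiniteMeasure μ] {I : Set ℝ}
  {h h' m : ℝ → X → ℝ} {C M t : ℝ}

theorem tendsto_integral_slope_mul (hI : Convex ℝ I) (ht : t ∈ I)
    (hder : ∀ᵐ x ∂μ, ∀ s ∈ I, HasDerivWithinAt (fun r => h r x) (h' s x) I s)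
    (hC : ∀ᵐ x ∂μ, ∀ s ∈ I, ‖h' s x‖ ≤ C) (hM : ∀ᵐ x ∂μ, ∀ s ∈ I, ‖m s x‖ ≤ M)
    (hhm : ∀ s ∈ I, AEStronglyMeasurable (h s) μ) (hmm : ∀ s ∈ I, AEStronglyMeasurable (m s) μ)
    (hmt : ∀ᵐ x ∂μ, ContinuousWithinAt (fun s => m s x) I t) :
    Tendsto (fun s => ∫ x, slope (fun r => h r x) t s * m s x ∂μ) (𝓝[I \ {t}] t)
      (𝓝 (∫ x, h' t x * m t x ∂μ)) := by
  refine tendsto_integral_filter_of_dominated_convergence (fun _ => C * M) ?_ ?_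
    (integrable_const _) ?_
  · filter_upwards [self_mem_nhdsWithin] with s hs
    exact (((hhm s hs.1).sub (hhm t ht)).const_smul (s - t)⁻¹).mul (hmm s hs.1)
  · filter_upwards [self_mem_nhdsWithin] with s hs
    filter_upwards [hder, hC, hM] with x hderx hCx hMx
    have hst : 0 < ‖s - t‖ := norm_pos_iff.2 (sub_ne_zero.2 hs.2)
    have hslope : ‖slope (fun r => h r x) t s‖ ≤ C := by
      rw [slope_def_field, norm_div, div_le_iff₀ hst]
      exact hI.norm_image_sub_le_of_norm_hasDerivWithin_le hderx hCx ht hs.1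
    rw [norm_mul]
    exact mul_le_mul hslope (hMx s hs.1) (norm_nonneg _) ((norm_nonneg _).trans hslope)
  · filter_upwards [hder, hmt] with x hderx hmtx
    exact (hasDerivWithinAt_iff_tendsto_slope.1 (hderx t ht)).mul
      (hmtx.mono_left (nhdsWithin_mono _ sdiff_subset))

theorem hasDerivWithinAt_integral (hI : Convex ℝ I) (ht : t ∈ I)
    (hder : ∀ᵐ x ∂μ, ∀ s ∈ I, HasDerivWithinAt (fun r => h r x) (h' s x) I s)
    (hC : ∀ᵐ x ∂μ, ∀ s ∈ I, ‖h' s x‖ ≤ C) (hint : ∀ s ∈ I, Integrable (h s) μ) :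
    HasDerivWithinAt (fun s => ∫ x, h s x ∂μ) (∫ x, h' t x ∂μ) I t := by
  have hlim := tendsto_integral_slope_mul (m := fun _ _ => 1) (M := 1) hI ht hder hC
    (ae_of_all _ fun _ _ _ => norm_one.le) (fun s hs => (hint s hs).aestronglyMeasurable)
    (fun _ _ => aestronglyMeasurable_const) (ae_of_all _ fun _ => continuousWithinAt_const)
  simp only [mul_one] at hlim
  rw [hasDerivWithinAt_iff_tendsto_slope]
  refine hlim.congr' ?_
  filter_upwards [self_mem_nhdsWithin] with s hs
  simp only [slope_def_field]
  rw [integral_div, integral_sub (hint s hs.1) (hint t ht)]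

end ParametricIntegral

/-! ### Powers -/

theorem laplacianWithin_of_mem_nhds {V : Type*} [NormedAddCommGroup V] [InnerProductSpace ℝ V]
    [FiniteDimensional ℝ V] {S : Set V} {x : V} (hS : UniqueDiffOn ℝ S) (hx : S ∈ 𝓝 x)
    (f : V → ℝ) : (Δ[S] f) x = (Δ f) x := by
  rw [InnerProductSpace.laplacianWithin_eq_iteratedFDerivWithin_stdOrthonormalBasis f hS
      (mem_of_mem_nhds hx), InnerProductSpace.laplacian_eq_iteratedFDeriv_stdOrthonormalBasis,
    iteratedFDerivWithin_congr_set (eventuallyEq_univ.2 hx)]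
  simp only [iteratedFDerivWithin_univ]

section Rpow

variable {V : Type*} [NormedAddCommGroup V] [InnerProductSpace ℝ V] {S : Set V} {f : V → ℝ} {x : V}

theorem fderivWithin_rpow_const (hS : UniqueDiffWithinAt ℝ S x)
    (hf : DifferentiableWithinAt ℝ f S x) (hfx : f x ≠ 0) (q : ℝ) :
    fderivWithin ℝ (fun y => f y ^ q) S x = (q * f x ^ (q - 1)) • fderivWithin ℝ f S x :=
  (hf.hasFDerivWithinAt.rpow_const (Or.inl hfx)).fderivWithin hS

theorem gradientWithin_rpow_const [CompleteSpace V] (hS : UniqueDiffWithinAt ℝ S x)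
    (hf : DifferentiableWithinAt ℝ f S x) (hfx : f x ≠ 0) (q : ℝ) :
    gradientWithin (fun y => f y ^ q) S x = (q * f x ^ (q - 1)) • gradientWithin f S x := by
  rw [gradientWithin, fderivWithin_rpow_const hS hf hfx, map_smul, gradientWithin]

theorem laplacianWithin_rpow_const [FiniteDimensional ℝ V] (hS : UniqueDiffOn ℝ S) (hx : x ∈ S)
    (hf : ContDiffOn ℝ 2 f S) (hne : ∀ y ∈ S, f y ≠ 0) (q : ℝ) :
    (Δ[S] fun y => f y ^ q) x = q * f x ^ (q - 1) * weightedLaplacianWithin S (q - 1) f x := by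
  have hfd : DifferentiableOn ℝ f S := hf.differentiableOn (by simp)
  have hgrad : DifferentiableOn ℝ (gradientWithin f S) S :=
    (contDiffOn_gradientWithin hS hf (m := 1) (by norm_num)).differentiableOn (by simp)
  have hpow : DifferentiableOn ℝ (fun y => f y ^ (q - 1)) S := fun y hy =>
    (hfd y hy).rpow_const (Or.inl (hne y hy))
  calc (Δ[S] fun y => f y ^ q) x
      = divWithin S (fun y => (q * f y ^ (q - 1)) • gradientWithin f S y) x := by
        rw [← divWithin_gradientWithin hS hx, divWithin, divWithin, fderivWithin_congr'
          (fun y hy => gradientWithin_rpow_const (hS y hy) (hfd y hy) (hne y hy) q) hx]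
    _ = q * fderivWithin ℝ (fun y => f y ^ (q - 1)) S x (gradientWithin f S x) +
          q * f x ^ (q - 1) * (Δ[S] f) x := by
        rw [divWithin_smul hS hx (hpow.const_mul q) hgrad, divWithin_gradientWithin hS hx,
          fderivWithin_const_mul (hS x hx) (hpow x hx), smul_apply, smul_eq_mul]
    _ = q * f x ^ (q - 1) * weightedLaplacianWithin S (q - 1) f x := by
        rw [fderivWithin_rpow_const (hS x hx) (hfd x hx) (hne x hx), smul_apply, smul_eq_mul,
          ← inner_gradientWithin_left, real_inner_self_eq_norm_sq, Real.rpow_sub_one (hne x hx),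
          weightedLaplacianWithin]
        ring

end Rpow

section Neumann

variable {d : ℕ} {Ω : Set (E d)} {v w : E d → ℝ}

theorem NeumannCondition.rpow_const (hΩ : IsSmoothConvexDomain Ω) (hv : NeumannCondition Ω v)
    (hvd : DifferentiableOn ℝ v (closure Ω)) (hne : ∀ x ∈ closure Ω, v x ≠ 0) (q : ℝ) :
    NeumannCondition Ω fun x => v x ^ q := fun y hy n hn => by
  have hyc := frontier_subset_closure hy
  rw [fderivWithin_rpow_const (hΩ.uniqueDiffOn y hyc) (hvd y hyc) (hne y hyc), smul_apply,
    hv y hy n hn, smul_zero]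

theorem NeumannCondition.add (hΩ : IsSmoothConvexDomain Ω) (hv : NeumannCondition Ω v)
    (hw : NeumannCondition Ω w) (hvd : DifferentiableOn ℝ v (closure Ω))
    (hwd : DifferentiableOn ℝ w (closure Ω)) : NeumannCondition Ω (v + w) := fun y hy n hn => by
  have hyc := frontier_subset_closure hy
  rw [fderivWithin_add (hΩ.uniqueDiffOn y hyc) (hvd y hyc) (hwd y hyc), add_apply, hv y hy n hn,
    hw y hy n hn, add_zero]

theorem fderivWithin_sub_gradientWithin_add {V : Type*} [NormedAddCommGroup V]
    [InnerProductSpace ℝ V] [CompleteSpace V] {S : Set V} {f g : V → ℝ} {x : V}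
    (hS : UniqueDiffWithinAt ℝ S x) (hf : DifferentiableWithinAt ℝ f S x)
    (hg : DifferentiableWithinAt ℝ g S x) :
    fderivWithin ℝ (f - g) S x (gradientWithin (f + g) S x) =
      ‖gradientWithin f S x‖ ^ 2 - ‖gradientWithin g S x‖ ^ 2 := by
  have hadd : gradientWithin (f + g) S x = gradientWithin f S x + gradientWithin g S x := by
    rw [gradientWithin, fderivWithin_add hS hf hg, map_add, gradientWithin, gradientWithin]
  rw [hadd, fderivWithin_sub hS hf hg, sub_apply, ← inner_gradientWithin_left,
    ← inner_gradientWithin_left, inner_add_right, inner_add_right, real_inner_self_eq_norm_sq,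
    real_inner_self_eq_norm_sq, real_inner_comm (gradientWithin f S x)]
  ring

-- Green's formula for `v - w` against `v + w`.
theorem IsSmoothConvexDomain.integral_norm_gradientWithin_sq_sub (hΩ : IsSmoothConvexDomain Ω)
    (hv : NeumannCondition Ω v) (hw : NeumannCondition Ω w) (hv2 : ContDiffOn ℝ 2 v (closure Ω))
    (hw2 : ContDiffOn ℝ 2 w (closure Ω)) :
    (∫ x in Ω, ‖gradientWithin v (closure Ω) x‖ ^ 2) -
        ∫ x in Ω, ‖gradientWithin w (closure Ω) x‖ ^ 2 =
      -∫ x in Ω, (v x - w x) * ((Δ[closure Ω] v) x + (Δ[closure Ω] w) x) := by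
  have hS := hΩ.uniqueDiffOn
  have hvd : DifferentiableOn ℝ v (closure Ω) := hv2.differentiableOn (by simp)
  have hwd : DifferentiableOn ℝ w (closure Ω) := hw2.differentiableOn (by simp)
  have hgrad : ∀ {f}, ContDiffOn ℝ 2 f (closure Ω) →
      IntegrableOn (fun x => ‖gradientWithin f (closure Ω) x‖ ^ 2) Ω := fun hf =>
    hΩ.integrableOn ((hΩ.continuousOn_gradientWithin (hf.of_le (by norm_num))).norm.pow 2)
  have hlap : ∀ {f}, ContDiffOn ℝ 2 f (closure Ω) →
      ContinuousOn (Δ[closure Ω] f) (closure Ω) := fun hf =>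
    (contDiffOn_laplacianWithin (m := 0) hS hf (by norm_num)).continuousOn
  have hprod : IntegrableOn
      (fun x => (v x - w x) * ((Δ[closure Ω] v) x + (Δ[closure Ω] w) x)) Ω :=
    hΩ.integrableOn ((hv2.continuousOn.sub hw2.continuousOn).mul ((hlap hv2).add (hlap hw2)))
  rw [← integral_sub (hgrad hv2) (hgrad hw2), eq_neg_iff_add_eq_zero,
    ← integral_add ((hgrad hv2).fun_sub (hgrad hw2)) hprod,
    ← hΩ.integral_fderivWithin_add_mul_laplacianWithin (hv.add hΩ hw hvd hwd) (hv2.add hw2)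
      (f := v - w) ((hv2.sub hw2).of_le (by norm_num : (1 : WithTop ℕ∞) ≤ 2))]
  refine setIntegral_congr_fun hΩ.isOpen.measurableSet fun x hx => ?_
  have hxc := subset_closure hx
  rw [Pi.sub_apply, fderivWithin_sub_gradientWithin_add (hS x hxc) (hvd x hxc) (hwd x hxc),
    (hv2 x hxc).laplacianWithin_add (hw2 x hxc) hS hxc]

end Neumann

/-! ### Evolution of integrals along the flow -/

section Flow

variable {d : ℕ} {Ω : Set (E d)} {p β t : ℝ} {I : Set ℝ} {v : ℝ → E d → ℝ}

namespace IsSmoothConvexDomain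

theorem integral_rpow_mul_weightedLaplacianWithin (hΩ : IsSmoothConvexDomain Ω) {f : E d → ℝ}
    (hf : NeumannCondition Ω f) (hf2 : ContDiffOn ℝ 2 f (closure Ω))
    (hne : ∀ x ∈ closure Ω, f x ≠ 0) (q c : ℝ) :
    ∫ x in Ω, f x ^ q * weightedLaplacianWithin (closure Ω) c f x =
      (c - q) * ∫ x in Ω, f x ^ (q - 1) * ‖gradientWithin f (closure Ω) x‖ ^ 2 := by
  have hf1 : ContDiffOn ℝ 1 f (closure Ω) := hf2.of_le (by norm_num)
  have hpow : ∀ r : ℝ, ContDiffOn ℝ 1 (fun x => f x ^ r) (closure Ω) := fun r =>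
    hf1.rpow_const_of_ne hne
  have hleft := hΩ.integrableOn ((hpow q).continuousOn.fun_mul
    (continuousOn_weightedLaplacianWithin hΩ.uniqueDiffOn hf2 hne c))
  have hright := hΩ.integrableOn ((hpow (q - 1)).continuousOn.fun_mul
    ((hΩ.continuousOn_gradientWithin hf1).norm.fun_pow 2))
  rw [← sub_eq_zero, ← integral_const_mul, ← integral_sub hleft (hright.const_mul _),
    ← hΩ.integral_fderivWithin_add_mul_laplacianWithin hf hf2 (hpow q)]
  refine setIntegral_congr_fun hΩ.isOpen.measurableSet fun x hx => ?_
  have hxc := subset_closure hx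
  beta_reduce
  rw [fderivWithin_rpow_const (hΩ.uniqueDiffOn x hxc) (hf1.differentiableOn (by simp) x hxc)
    (hne x hxc), smul_apply, smul_eq_mul, ← inner_gradientWithin_left, real_inner_self_eq_norm_sq,
    weightedLaplacianWithin, Real.rpow_sub_one (hne x hxc)]
  ring

-- By Green's formula the difference quotient of the energy is that of `u` integrated against
-- `Δu(s) + Δu(t)`, so that no time derivative of `∇u` is needed.
theorem hasDerivWithinAt_integral_norm_gradientWithin_sq (hΩ : IsSmoothConvexDomain Ω)
    {u u' : ℝ → E d → ℝ} (hI : IsCompact I) (hIc : Convex ℝ I) (ht : t ∈ I)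
    (hu : ∀ s ∈ I, NeumannCondition Ω (u s)) (hu2 : ∀ s ∈ I, ContDiffOn ℝ 2 (u s) (closure Ω))
    (hder : ∀ x ∈ Ω, ∀ s ∈ I, HasDerivWithinAt (fun r => u r x) (u' s x) I s)
    (hu' : ContinuousOn (fun z : ℝ × E d => u' z.1 z.2) (I ×ˢ closure Ω))
    (hlap : ContinuousOn (fun z : ℝ × E d => (Δ[closure Ω] (u z.1)) z.2) (I ×ˢ closure Ω)) :
    HasDerivWithinAt (fun s => ∫ x in Ω, ‖gradientWithin (u s) (closure Ω) x‖ ^ 2)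
      (-2 * ∫ x in Ω, u' t x * (Δ[closure Ω] (u t)) x) I t := by
  have : IsFiniteMeasure (volume.restrict Ω) :=
    isFiniteMeasure_restrict.2 hΩ.isBounded.measure_lt_top.ne
  have hmeas : MeasurableSet Ω := hΩ.isOpen.measurableSet
  have hlap_slice : ∀ s ∈ I, ContinuousOn (Δ[closure Ω] (u s)) Ω := fun s hs =>
    hlap.comp (f := fun x => (s, x)) (by fun_prop) fun x hx => ⟨hs, subset_closure hx⟩
  have hlap_time : ∀ x ∈ Ω, ContinuousWithinAt (fun s => (Δ[closure Ω] (u s)) x) I t := fun x hx =>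
    hlap.comp (f := fun s => (s, x)) (by fun_prop) (fun s hs => ⟨hs, subset_closure hx⟩) t ht
  obtain ⟨C, hC⟩ := (hI.prod hΩ.isCompact_closure).exists_bound_of_continuousOn hu'
  obtain ⟨M, hM⟩ := (hI.prod hΩ.isCompact_closure).exists_bound_of_continuousOn hlap
  have hlim := tendsto_integral_slope_mul (μ := volume.restrict Ω) (M := M + M)
    (m := fun s x => (Δ[closure Ω] (u s)) x + (Δ[closure Ω] (u t)) x) hIc ht
    (ae_restrict_of_forall_mem hmeas hder)
    (ae_restrict_of_forall_mem hmeas fun x hx s hs => hC (s, x) ⟨hs, subset_closure hx⟩)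
    (ae_restrict_of_forall_mem hmeas fun x hx s hs =>
      norm_add_le_of_le (hM (s, x) ⟨hs, subset_closure hx⟩) (hM (t, x) ⟨ht, subset_closure hx⟩))
    (fun s hs => ((hu2 s hs).continuousOn.mono subset_closure).aestronglyMeasurable hmeas)
    (fun s hs => ((hlap_slice s hs).add (hlap_slice t ht)).aestronglyMeasurable hmeas)
    (ae_restrict_of_forall_mem hmeas fun x hx => (hlap_time x hx).add continuousWithinAt_const)
  rw [hasDerivWithinAt_iff_tendsto_slope]
  convert! hlim.neg.congr' ?_ using 2
  · rw [neg_mul, ← integral_const_mul]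
    simp only [← two_mul, mul_left_comm]
  · filter_upwards [self_mem_nhdsWithin] with s hs
    rw [slope_def_field, hΩ.integral_norm_gradientWithin_sq_sub (hu s hs.1) (hu t ht) (hu2 s hs.1)
      (hu2 t ht), neg_div, ← integral_div]
    simp only [slope_def_field, div_mul_eq_mul_div]

end IsSmoothConvexDomain

namespace IsFlowSolution

theorem mono (hv : IsFlowSolution Ω p β I v) {J : Set ℝ} (hJ : J ⊆ I) :
    IsFlowSolution Ω p β J v where
  pos t ht := hv.pos t (hJ ht)
  contDiffOn t ht := hv.contDiffOn t (hJ ht)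
  continuousOn k hk := (hv.continuousOn k hk).mono (prod_mono hJ subset_rfl)
  equation t ht x hx := (hv.equation t (hJ ht) x hx).mono hJ
  neumann t ht := hv.neumann t (hJ ht)

theorem continuousOn_prod (hv : IsFlowSolution Ω p β I v) :
    ContinuousOn (fun z : ℝ × E d => v z.1 z.2) (I ×ˢ closure Ω) :=
  ((ContinuousMultilinearMap.apply ℝ (fun _ : Fin 0 => E d) ℝ 0).continuous.comp_continuousOn
    (hv.continuousOn 0 zero_le_two)).congr fun z _ =>
      (iteratedFDerivWithin_zero_apply (𝕜 := ℝ) (s := closure Ω) (f := v z.1) (x := z.2) 0).symm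

theorem continuousOn_rpow (hv : IsFlowSolution Ω p β I v) (q : ℝ) :
    ContinuousOn (fun z : ℝ × E d => v z.1 z.2 ^ q) (I ×ˢ closure Ω) :=
  hv.continuousOn_prod.rpow_const fun z hz => Or.inl (hv.pos z.1 hz.1 z.2 hz.2).ne'

theorem continuousOn_norm_gradientWithin (hv : IsFlowSolution Ω p β I v)
    (hΩ : IsSmoothConvexDomain Ω) :
    ContinuousOn (fun z : ℝ × E d => ‖gradientWithin (v z.1) (closure Ω) z.2‖)
      (I ×ˢ closure Ω) :=
  (hv.continuousOn 1 one_le_two).norm.congr fun z hz => by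
    beta_reduce
    rw [norm_iteratedFDerivWithin_one _ (hΩ.uniqueDiffOn z.2 hz.2), gradientWithin,
      LinearIsometryEquiv.norm_map]

theorem continuousOn_laplacianWithin (hv : IsFlowSolution Ω p β I v)
    (hΩ : IsSmoothConvexDomain Ω) :
    ContinuousOn (fun z : ℝ × E d => (Δ[closure Ω] (v z.1)) z.2) (I ×ˢ closure Ω) := by
  let b := EuclideanSpace.basisFun (Fin d) ℝ
  refine (continuousOn_finsetSum Finset.univ fun i _ =>
    (ContinuousMultilinearMap.apply ℝ (fun _ : Fin 2 => E d) ℝ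
      ![b i, b i]).continuous.comp_continuousOn (hv.continuousOn 2 le_rfl)).congr fun z hz => ?_
  exact InnerProductSpace.laplacianWithin_eq_iteratedFDerivWithin_orthonormalBasis _
    hΩ.uniqueDiffOn hz.2 b

theorem continuousOn_weightedLaplacianWithin (hv : IsFlowSolution Ω p β I v)
    (hΩ : IsSmoothConvexDomain Ω) (c : ℝ) :
    ContinuousOn (fun z : ℝ × E d => weightedLaplacianWithin (closure Ω) c (v z.1) z.2)
      (I ×ˢ closure Ω) :=
  (hv.continuousOn_laplacianWithin hΩ).add (continuousOn_const.mul
    (((hv.continuousOn_norm_gradientWithin hΩ).pow 2).div hv.continuousOn_prod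
      fun z hz => (hv.pos z.1 hz.1 z.2 hz.2).ne'))

theorem hasDerivWithinAt_rpow (hv : IsFlowSolution Ω p β I v) (hΩ : IsSmoothConvexDomain Ω)
    (q : ℝ) (ht : t ∈ I) {x : E d} (hx : x ∈ Ω) :
    HasDerivWithinAt (fun s => v s x ^ q) (q * (v t x ^ (q + 1 - 2 * β) *
      weightedLaplacianWithin (closure Ω) (kappa p β) (v t) x)) I t := by
  have hpos := hv.pos t ht x (subset_closure hx)
  have hspeed : Δ (v t) x + kappa p β * (‖∇ (v t) x‖ ^ 2 / v t x) =
      weightedLaplacianWithin (closure Ω) (kappa p β) (v t) x := by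
    rw [weightedLaplacianWithin, gradientWithin_of_mem_nhds (hΩ.closure_mem_nhds hx),
      laplacianWithin_of_mem_nhds hΩ.uniqueDiffOn (hΩ.closure_mem_nhds hx)]
  refine ((hv.equation t ht x hx).rpow_const (p := q) (Or.inl hpos.ne')).congr_deriv ?_
  rw [hspeed, show q + 1 - 2 * β = (2 - 2 * β) + (q - 1) by ring, Real.rpow_add hpos]
  ring

theorem hasDerivWithinAt_integral_rpow (hv : IsFlowSolution Ω p β I v)
    (hΩ : IsSmoothConvexDomain Ω) (hI : IsCompact I) (hIc : Convex ℝ I) (q : ℝ) (ht : t ∈ I) :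
    HasDerivWithinAt (fun s => ∫ x in Ω, v s x ^ q) (q * ((β * (p + 1) - q) *
      ∫ x in Ω, v t x ^ (q - 2 * β) * ‖gradientWithin (v t) (closure Ω) x‖ ^ 2)) I t := by
  have : IsFiniteMeasure (volume.restrict Ω) :=
    isFiniteMeasure_restrict.2 hΩ.isBounded.measure_lt_top.ne
  obtain ⟨C, hC⟩ := (hI.prod hΩ.isCompact_closure).exists_bound_of_continuousOn
    ((continuousOn_const (c := q)).mul ((hv.continuousOn_rpow (q + 1 - 2 * β)).mul
      (hv.continuousOn_weightedLaplacianWithin hΩ (kappa p β))))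
  refine (hasDerivWithinAt_integral (μ := volume.restrict Ω) hIc ht
    (ae_restrict_of_forall_mem hΩ.isOpen.measurableSet fun x hx s hs =>
      hv.hasDerivWithinAt_rpow hΩ q hs hx)
    (ae_restrict_of_forall_mem hΩ.isOpen.measurableSet fun x hx s hs =>
      hC (s, x) ⟨hs, subset_closure hx⟩) fun s hs => hΩ.integrableOn
        ((hv.contDiffOn s hs).continuousOn.rpow_const fun x hx =>
          Or.inl (hv.pos s hs x hx).ne')).congr_deriv ?_
  rw [integral_const_mul, hΩ.integral_rpow_mul_weightedLaplacianWithin (hv.neumann t ht)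
    ((hv.contDiffOn t ht).of_le (by norm_num)) fun x hx => (hv.pos t ht x hx).ne']
  congr 2
  · rw [kappa]
    ring
  · ring_nf

theorem hasDerivWithinAt_integral_norm_gradientWithin_rpow_sq (hv : IsFlowSolution Ω p β I v)
    (hΩ : IsSmoothConvexDomain Ω) (hI : IsCompact I) (hIc : Convex ℝ I) (ht : t ∈ I) :
    HasDerivWithinAt
      (fun s => ∫ x in Ω, ‖gradientWithin (fun y => v s y ^ β) (closure Ω) x‖ ^ 2)
      (-(2 * β ^ 2) * ∫ x in Ω, weightedLaplacianWithin (closure Ω) (β - 1) (v t) x *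
        weightedLaplacianWithin (closure Ω) (kappa p β) (v t) x) I t := by
  have hne : ∀ s ∈ I, ∀ x ∈ closure Ω, v s x ≠ 0 := fun s hs x hx => (hv.pos s hs x hx).ne'
  have hv2 : ∀ s ∈ I, ContDiffOn ℝ 2 (v s) (closure Ω) := fun s hs =>
    (hv.contDiffOn s hs).of_le (by norm_num)
  have hlap : ∀ s ∈ I, ∀ x ∈ closure Ω, (Δ[closure Ω] fun y => v s y ^ β) x =
      β * v s x ^ (β - 1) * weightedLaplacianWithin (closure Ω) (β - 1) (v s) x :=
    fun s hs x hx => laplacianWithin_rpow_const hΩ.uniqueDiffOn hx (hv2 s hs) (hne s hs) β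
  refine (hΩ.hasDerivWithinAt_integral_norm_gradientWithin_sq hI hIc ht
    (fun s hs => (hv.neumann s hs).rpow_const hΩ ((hv2 s hs).differentiableOn (by simp))
      (hne s hs) β)
    (fun s hs => (hv2 s hs).rpow_const_of_ne (hne s hs))
    (fun x hx s hs => hv.hasDerivWithinAt_rpow hΩ β hs hx)
    (continuousOn_const.mul ((hv.continuousOn_rpow _).mul
      (hv.continuousOn_weightedLaplacianWithin hΩ _)))
    (((continuousOn_const.mul (hv.continuousOn_rpow (β - 1))).mul
      (hv.continuousOn_weightedLaplacianWithin hΩ (β - 1))).congr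
      fun z hz => hlap z.1 hz.1 z.2 hz.2)).congr_deriv ?_
  rw [neg_mul, neg_mul, mul_assoc, ← integral_const_mul (β ^ 2)]
  congr 2
  refine setIntegral_congr_fun hΩ.isOpen.measurableSet fun x hx => ?_
  have hpow : v t x ^ (β + 1 - 2 * β) * v t x ^ (β - 1) = 1 := by
    rw [← Real.rpow_add (hv.pos t ht x (subset_closure hx)),
      show β + 1 - 2 * β + (β - 1) = 0 by ring, Real.rpow_zero]
  beta_reduce
  rw [hlap t ht x (subset_closure hx)]
  linear_combination β ^ 2 * weightedLaplacianWithin (closure Ω) (β - 1) (v t) x *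
    weightedLaplacianWithin (closure Ω) (kappa p β) (v t) x * hpow

end IsFlowSolution
end Flow

/-! ### Evolution of the functional -/

section Functional

variable {d : ℕ} {Ω : Set (E d)} {p β θ Λ t : ℝ} {I : Set ℝ} {f : E d → ℝ} {v : ℝ → E d → ℝ}

theorem normL_rpow_const (hΩ : MeasurableSet Ω) (hf : ∀ x ∈ Ω, 0 < f x) (q β : ℝ) :
    normL Ω q (fun x => f x ^ β) = (∫ x in Ω, f x ^ (β * q)) ^ (1 / q) := by
  rw [normL]
  congr 1
  refine setIntegral_congr_fun hΩ fun x hx => ?_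
  rw [abs_of_pos (Real.rpow_pos_of_pos (hf x hx) β), ← Real.rpow_mul (hf x hx).le]

theorem sq_normL_two_rpow_const (hΩ : MeasurableSet Ω) (hf : ∀ x ∈ Ω, 0 < f x) (β : ℝ) :
    normL Ω 2 (fun x => f x ^ β) ^ 2 = ∫ x in Ω, f x ^ (β * 2) := by
  rw [normL_rpow_const hΩ hf, ← Real.sqrt_eq_rpow, Real.sq_sqrt]
  exact setIntegral_nonneg hΩ fun x hx => Real.rpow_nonneg (hf x hx).le _

namespace IsSmoothConvexDomain

theorem integral_rpow_pos (hΩ : IsSmoothConvexDomain Ω) (hfc : ContinuousOn f (closure Ω))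
    (hf : ∀ x ∈ closure Ω, 0 < f x) (q : ℝ) : 0 < ∫ x in Ω, f x ^ q := by
  have hpos : ∀ x ∈ Ω, 0 < f x ^ q := fun x hx => Real.rpow_pos_of_pos (hf x (subset_closure hx)) q
  rw [setIntegral_pos_iff_support_of_nonneg_ae
    (ae_restrict_of_forall_mem hΩ.isOpen.measurableSet fun x hx => (hpos x hx).le)
    (hΩ.integrableOn (hfc.rpow_const fun x hx => Or.inl (hf x hx).ne')),
    inter_eq_self_of_subset_right (t := Ω) fun x hx => Function.mem_support.2 (hpos x hx).ne']
  exact hΩ.isOpen.measure_pos volume hΩ.nonempty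

theorem functionalJ_rpow_const (hΩ : IsSmoothConvexDomain Ω) (hf : ∀ x ∈ Ω, 0 < f x)
    (p Λ β : ℝ) :
    functionalJ Ω p Λ (fun x => f x ^ β) =
      (∫ x in Ω, ‖gradientWithin (fun y => f y ^ β) (closure Ω) x‖ ^ 2) - Λ / (p - 1) *
        (((∫ x in Ω, f x ^ (β * (p + 1))) ^ (1 / (p + 1))) ^ 2 - ∫ x in Ω, f x ^ (β * 2)) := by
  have hmeas := hΩ.isOpen.measurableSet
  rw [functionalJ, sq_normL_two_rpow_const hmeas hf, normL_rpow_const hmeas hf]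
  congr 1
  refine setIntegral_congr_fun hmeas fun x hx => ?_
  beta_reduce
  rw [gradientWithin_of_mem_nhds (hΩ.closure_mem_nhds hx)]

theorem integrableOn_norm_gradient_pow_div (hΩ : IsSmoothConvexDomain Ω)
    (hf1 : ContDiffOn ℝ 1 f (closure Ω)) (hne : ∀ x ∈ closure Ω, f x ≠ 0) (m n : ℕ) :
    IntegrableOn (fun x => ‖∇ f x‖ ^ m / f x ^ n) Ω := by
  have hcont := ((hΩ.continuousOn_gradientWithin hf1).norm.fun_pow m).div
    (hf1.continuousOn.fun_pow n) fun x hx => pow_ne_zero n (hne x hx)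
  refine (hΩ.integrableOn hcont).congr_fun (fun x hx => ?_) hΩ.isOpen.measurableSet
  rw [Pi.div_apply, gradientWithin_of_mem_nhds (hΩ.closure_mem_nhds hx)]

end IsSmoothConvexDomain

-- The norm in `L^(p+1)` is constant along the flow, so it does not contribute.
theorem IsFlowSolution.hasDerivWithinAt_functionalJ (hv : IsFlowSolution Ω p β I v)
    (hΩ : IsSmoothConvexDomain Ω) (hp1 : p ≠ 1) (Λ : ℝ) (hI : IsCompact I) (hIc : Convex ℝ I)
    (ht : t ∈ I) :
    HasDerivWithinAt (fun s => functionalJ Ω p Λ fun x => v s x ^ β)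
      (-(2 * β ^ 2) * ((∫ x in Ω, weightedLaplacianWithin (closure Ω) (β - 1) (v t) x *
          weightedLaplacianWithin (closure Ω) (kappa p β) (v t) x) -
        Λ * ∫ x in Ω, ‖gradientWithin (v t) (closure Ω) x‖ ^ 2)) I t := by
  have henergy := hv.hasDerivWithinAt_integral_norm_gradientWithin_rpow_sq hΩ hI hIc ht
  have hmass := hv.hasDerivWithinAt_integral_rpow hΩ hI hIc (β * 2) ht
  have hnorm := ((hv.hasDerivWithinAt_integral_rpow hΩ hI hIc (β * (p + 1)) ht).rpow_const
    (p := 1 / (p + 1)) (Or.inl (hΩ.integral_rpow_pos (hv.contDiffOn t ht).continuousOn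
      (hv.pos t ht) _).ne')).fun_pow 2
  have hJ : ∀ s ∈ I, functionalJ Ω p Λ (fun x => v s x ^ β) = _ := fun s hs =>
    hΩ.functionalJ_rpow_const (fun x hx => hv.pos s hs x (subset_closure hx)) p Λ β
  refine ((henergy.fun_sub ((hnorm.fun_sub hmass).const_mul (Λ / (p - 1)))).congr hJ
    (hJ t ht)).congr_deriv ?_
  have hp : p - 1 ≠ 0 := sub_ne_zero.2 hp1
  rw [mul_comm β 2]
  simp only [sub_self, Real.rpow_zero, one_mul, zero_mul, mul_zero]
  field_simp
  ring

theorem exists_Icc_mem_nhdsWithin (hI : I.OrdConnected) (ht : t ∈ I) :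
    ∃ a b, Icc a b ⊆ I ∧ t ∈ Icc a b ∧ Icc a b ∈ 𝓝[I] t := by
  have hleft : ∃ a ∈ I, a ≤ t ∧ Ici a ∈ 𝓝[I] t := by
    by_cases! h : ∃ a ∈ I, a < t
    · obtain ⟨a, ha, hat⟩ := h
      exact ⟨a, ha, hat.le, mem_nhdsWithin_of_mem_nhds (Ici_mem_nhds hat)⟩
    · exact ⟨t, ht, le_rfl, mem_of_superset self_mem_nhdsWithin h⟩
  have hright : ∃ b ∈ I, t ≤ b ∧ Iic b ∈ 𝓝[I] t := by
    by_cases! h : ∃ b ∈ I, t < b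
    · obtain ⟨b, hb, htb⟩ := h
      exact ⟨b, hb, htb.le, mem_nhdsWithin_of_mem_nhds (Iic_mem_nhds htb)⟩
    · exact ⟨t, ht, le_rfl, mem_of_superset self_mem_nhdsWithin h⟩
  obtain ⟨a, ha, hat, ha_nhds⟩ := hleft
  obtain ⟨b, hb, htb, hb_nhds⟩ := hright
  exact ⟨a, b, hI.out ha hb, ⟨hat, htb⟩, inter_mem ha_nhds hb_nhds⟩

theorem IsFlowSolution.exists_hasDerivWithinAt_functionalJ_le (hv : IsFlowSolution Ω p β I v)
    (hΩ : IsSmoothConvexDomain Ω) (hp1 : p ≠ 1) (hθ0 : 0 < θ) (hθ1 : θ ≤ 1)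
    (hΛ : Λ ≤ (1 - θ) * lambda2 Ω) (hI : I.OrdConnected) (ht : t ∈ I) :
    ∃ D : ℝ, HasDerivWithinAt (fun s => functionalJ Ω p Λ fun x => v s x ^ β) D I t ∧
      D ≤ -2 * constR θ p d β * β ^ 2 * ∫ x in Ω, ‖∇ (v t) x‖ ^ 4 / v t x ^ 2 := by
  obtain ⟨a, b, hab, htab, hnhds⟩ := exists_Icc_mem_nhdsWithin hI ht
  refine ⟨_, ((hv.mono hab).hasDerivWithinAt_functionalJ hΩ hp1 Λ isCompact_Icc (convex_Icc a b)
    htab).mono_of_mem_nhdsWithin hnhds, ?_⟩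
  have hgrad : ∫ x in Ω, ‖∇ (v t) x‖ ^ 4 / v t x ^ 2 =
      ∫ x in Ω, ‖gradientWithin (v t) (closure Ω) x‖ ^ 4 / v t x ^ 2 :=
    setIntegral_congr_fun hΩ.isOpen.measurableSet fun x hx => by
      beta_reduce
      rw [gradientWithin_of_mem_nhds (hΩ.closure_mem_nhds hx)]
  have hdissipation := hΩ.constR_mul_integral_le (hv.neumann t ht) (hv.contDiffOn t ht)
    (fun x hx => (hv.pos t ht x hx).ne') hθ0 hθ1 p β hΛ
  rw [hgrad]
  linarith [mul_le_mul_of_nonneg_left hdissipation (mul_nonneg zero_le_two (sq_nonneg β))]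

end Functional

/-! ### The roots of `R` -/

section Parameters

variable {d : ℕ} {p θ : ℝ}

theorem constR_eq_neg_quadratic (θ p : ℝ) (d : ℕ) (β : ℝ) :
    constR θ p d β = -(coefA θ p d * β ^ 2 - 2 * coefB p d * β + 1) := by
  have hd : (d : ℝ) + 2 ≠ 0 := by positivity
  rw [constR, coefA, coefB, kappa]
  field_simp
  ring

theorem thetaStar_nonneg (hp0 : 0 ≤ p) : 0 ≤ thetaStar p d := by
  rw [thetaStar]
  positivity

theorem coefA_lt_sq_coefB (hp0 : 0 < p) (hθ : thetaStar p d < θ) :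
    coefA θ p d < coefB p d ^ 2 := by
  have hθ0 : 0 < θ := (thetaStar_nonneg hp0.le).trans_lt hθ
  have hdisc : coefB p d ^ 2 - coefA θ p d =
      p / ((d + 2) ^ 2 * θ) * (θ * (d * (d + 2) + p) - (d - 1) ^ 2 * p) := by
    rw [coefA, coefB]
    field_simp
    ring
  rw [thetaStar, div_lt_iff₀ (by positivity)] at hθ
  rw [← sub_pos, hdisc]
  exact mul_pos (by positivity) (sub_pos.2 hθ)

theorem constR_eq_mul (h : coefA θ p d ≤ coefB p d ^ 2) (ha : coefA θ p d ≠ 0) (β : ℝ) :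
    constR θ p d β = -(coefA θ p d * ((β - betaMinus θ p d) * (β - betaPlus θ p d))) := by
  have hsqrt := Real.sq_sqrt (sub_nonneg.2 h)
  rw [constR_eq_neg_quadratic, betaMinus, betaPlus]
  field_simp
  linear_combination -hsqrt

theorem betaPlus_sub_betaMinus (θ p : ℝ) (d : ℕ) :
    betaPlus θ p d - betaMinus θ p d = 2 * √(coefB p d ^ 2 - coefA θ p d) / coefA θ p d := by
  rw [betaMinus, betaPlus]
  ring

theorem betaMinus_ne_betaPlus (h : coefA θ p d < coefB p d ^ 2) (ha : coefA θ p d ≠ 0) :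
    betaMinus θ p d ≠ betaPlus θ p d := by
  rw [ne_comm, ← sub_ne_zero, betaPlus_sub_betaMinus]
  exact div_ne_zero (mul_ne_zero two_ne_zero (Real.sqrt_pos.2 (sub_pos.2 h)).ne') ha

theorem betaMinus_lt_betaPlus (h : coefA θ p d < coefB p d ^ 2) (ha : 0 < coefA θ p d) :
    betaMinus θ p d < betaPlus θ p d := by
  rw [← sub_pos, betaPlus_sub_betaMinus]
  exact div_pos (mul_pos two_pos (Real.sqrt_pos.2 (sub_pos.2 h))) ha

theorem constR_eq_zero_iff (h : coefA θ p d ≤ coefB p d ^ 2) (ha : coefA θ p d ≠ 0) (β : ℝ) :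
    constR θ p d β = 0 ↔ β = betaMinus θ p d ∨ β = betaPlus θ p d := by
  simp [constR_eq_mul h ha, ha, sub_eq_zero]

theorem constR_pos_iff (h : coefA θ p d < coefB p d ^ 2) (ha : 0 < coefA θ p d) (β : ℝ) :
    0 < constR θ p d β ↔ β ∈ Ioo (betaMinus θ p d) (betaPlus θ p d) := by
  have hlt := betaMinus_lt_betaPlus h ha
  rw [constR_eq_mul h.le ha.ne', ← mul_neg, mul_pos_iff_of_pos_left ha, neg_pos,
    mul_neg_iff, mem_Ioo]
  grind

end Parameters

end NeumannFlow

open NeumannFlow in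
theorem mainTheorem7_general {d : ℕ} {Ω : Set (E d)} (hΩ : IsSmoothConvexDomain Ω)
    {p θ : ℝ} (hp0 : 0 < p) (hp1 : p ≠ 1) (hθ : θ ∈ Ioc (thetaStar p d) 1) :
    (coefA θ p d ≠ 0 → betaMinus θ p d ≠ betaPlus θ p d ∧
      ∀ β, constR θ p d β = 0 ↔ β = betaMinus θ p d ∨ β = betaPlus θ p d) ∧
    (0 < coefA θ p d → betaMinus θ p d < betaPlus θ p d ∧
      ∀ β, 0 < constR θ p d β ↔ β ∈ Ioo (betaMinus θ p d) (betaPlus θ p d)) ∧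
    ∀ β Λ, Λ ≤ (1 - θ) * lambda2 Ω → ∀ I : Set ℝ, I.OrdConnected →
      ∀ v, IsFlowSolution Ω p β I v → ∀ t ∈ I,
        IntegrableOn (fun x => ‖∇ (v t) x‖ ^ 4 / v t x ^ 2) Ω ∧
        ∃ D, HasDerivWithinAt (fun s => functionalJ Ω p Λ fun x => v s x ^ β) D I t ∧
          D ≤ -2 * constR θ p d β * β ^ 2 * ∫ x in Ω, ‖∇ (v t) x‖ ^ 4 / v t x ^ 2 := by
  have hθ0 : 0 < θ := (thetaStar_nonneg hp0.le).trans_lt hθ.1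
  have hdisc := coefA_lt_sq_coefB hp0 hθ.1
  refine ⟨fun ha => ⟨betaMinus_ne_betaPlus hdisc ha, constR_eq_zero_iff hdisc.le ha⟩,
    fun ha => ⟨betaMinus_lt_betaPlus hdisc ha, constR_pos_iff hdisc ha⟩,
    fun β Λ hΛ I hI v hv t ht => ⟨?_, ?_⟩⟩
  · exact hΩ.integrableOn_norm_gradient_pow_div ((hv.contDiffOn t ht).of_le (by norm_num))
      (fun x hx => (hv.pos t ht x hx).ne') 4 2
  · exact hv.exists_hasDerivWithinAt_functionalJ_le hΩ hp1 hθ0 hθ.2 hΛ hI ht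

theorem mainTheorem7 {d : ℕ} (hd : 1 ≤ d) (Ω : Set (NeumannFlow.E d))
    (hΩ_open : IsOpen Ω) (hΩ_bdd : Bornology.IsBounded Ω) (hΩ_conv : Convex ℝ Ω)
    (hΩ_smooth : NeumannFlow.HasSmoothBoundary Ω) (hΩ_vol : volume Ω = 1)
    (p : ℝ) (hp0 : 0 < p) (hp1 : p ≠ 1)
    (θ : ℝ) (hθ : θ ∈ Ioo (NeumannFlow.thetaStar p d) 1) :
    -- `R = 0` has the two roots `β₋`, `β₊`
    (NeumannFlow.coefA θ p d ≠ 0 →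
      NeumannFlow.betaMinus θ p d ≠ NeumannFlow.betaPlus θ p d ∧
      ∀ β : ℝ, NeumannFlow.constR θ p d β = 0 ↔
        β = NeumannFlow.betaMinus θ p d ∨ β = NeumannFlow.betaPlus θ p d) ∧
    -- `R > 0` exactly on `(β₋, β₊)`
    (0 < NeumannFlow.coefA θ p d →
      NeumannFlow.betaMinus θ p d < NeumannFlow.betaPlus θ p d ∧
      ∀ β : ℝ, 0 < NeumannFlow.constR θ p d β ↔
        β ∈ Ioo (NeumannFlow.betaMinus θ p d) (NeumannFlow.betaPlus θ p d)) ∧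
    -- the decay of the functional along the flow
    (∀ β : ℝ, 0 < NeumannFlow.constR θ p d β →
      ∀ Λ : ℝ, Λ ≤ (1 - θ) * NeumannFlow.lambda2 Ω →
      ∀ I : Set ℝ, I.OrdConnected → I.Nontrivial →
      ∀ v : ℝ → NeumannFlow.E d → ℝ, NeumannFlow.IsFlowSolution Ω p β I v →
      ∀ t ∈ I,
        IntegrableOn (fun x => ‖∇ (v t) x‖ ^ 4 / v t x ^ 2) Ω ∧
        ∃ D : ℝ,
          HasDerivWithinAt (fun s => NeumannFlow.functionalJ Ω p Λ (fun x => v s x ^ β)) D I t ∧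
          D ≤ -(NeumannFlow.constR θ p d β) * β ^ 2 *
            ∫ x in Ω, ‖∇ (v t) x‖ ^ 4 / v t x ^ 2) := by
  open NeumannFlow in
  have hΩ : IsSmoothConvexDomain Ω := ⟨hΩ_open, hΩ_bdd, hΩ_conv,
    nonempty_of_measure_ne_zero (hΩ_vol ▸ one_ne_zero), hΩ_smooth⟩
  obtain ⟨hroots, hpos, hdecay⟩ := mainTheorem7_general hΩ hp0 hp1 (Ioo_subset_Ioc_self hθ)
  refine ⟨hroots, hpos, fun β hR Λ hΛ I hI _ v hv t ht => ?_⟩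
  obtain ⟨hint, D, hD, hle⟩ := hdecay β Λ hΛ I hI v hv t ht
  have hX : 0 ≤ ∫ x in Ω, ‖∇ (v t) x‖ ^ 4 / v t x ^ 2 := integral_nonneg fun x => by positivity
  exact ⟨hint, D, hD, by linarith [mul_nonneg (mul_nonneg hR.le (sq_nonneg β)) hX]⟩
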